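/- Fix a commutative ring $\kappa$. All algebras are associative commutative $\kappa$-algebras, not necessarily with identity; an action of $S$ on $M$ is a $\kappa$-bilinear map $(r,m)\mapsto r\blacktriangleright m$ with $r\blacktriangleright(mm')=(r\blacktriangleright m)m'$ and $(rr')\blacktriangleright m=r\blacktriangleright(r'\blacktriangleright m)$; $S\ltimes M$ has product $(r,m)(r',m')=(rr',r\blacktriangleright m'+r'\blacktriangleright m+mm')$. **2-crossed modules.** A 2-crossed module $\mathcal A=(L\xrightarrow{\partial_2}E\xrightarrow{\partial_1}R)$ is a complex of algebras with actions of $R$ on $E$ and $L$ such that $\partial_1(r\blacktriangleright e)=r\,\partial_1(e)$ and $\partial_2(r\blacktriangleright l)=r\blacktriangleright\partial_2(l)$, and a $\kappa$-bilinear map $\{\,\otimes\,\}:E\times E\to L$ such that, with $e\blacktriangleright' l:=\{e\otimes\partial_2 l\}$, $$\partial_2\{e\otimes e'\}=ee'-\partial_1(e')\blacktriangleright e,\quad \{\partial_2 l\otimes\partial_2 l'\}=ll',\quad \{e\otimes e'e''\}=\{ee'\otimes e''\}+\partial_1(e'')\blacktriangleright\{e\otimes e'\},$$ $$\{\partial_2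 l\otimes e\}=e\blacktriangleright' l-\partial_1(e)\blacktriangleright l,\quad r\blacktriangleright\{e\otimes e'\}=\{r\blacktriangleright e\otimes e'\}=\{e\otimes r\blacktriangleright e'\}.$$ A map $f=(f_2,f_1,f_0):\mathcal A\to\mathcal A'$ is a triple of algebra maps commuting with $\partial_1,\partial_2$, the actions and the liftings. $\mathcal A$ is *free up to order one*, with chosen basis $B$, if $R$ is the free algebra on $B$. Either of two conventions may be used throughout: (a) no identities are required, and the free algebra on $B$ consists of the polynomials in $\kappa[B]$ with zero constant term; (b) the algebras $R$ have an identity, which acts as the identity on $E$ and $L$, the maps $f_0$ preserve it, the maps $s$ and $q$ below are required to vanish on it, and the free algebra on $B$ is $\kappa[B]$. **Homotopies.** A homotopy $(f,s,t):f\to g$ consists of linear maps $s:R\to E'$, $t:E\to L'$ with $$s(rr')=f_0(r)\blacktriangleright s(r')+f_0(r')\blacktriangleright s(r)+s(r)s(r')$$ (that is, $s$ is an $f_0$-derivation), $$t(ee')=\{s\partial_1e\otimes f_1e'\}+\{s\partial_1e'\otimes f_1e\}+f_1e\blacktriangleright' te'+f_1e'\blacktriangleright' te+s\partial_1e\blacktriangleright'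 te'+s\partial_1e'\blacktriangleright' te+te\,te',$$ $$t(r\blacktriangleright e)=f_0(r)\blacktriangleright te+\partial_1's(r)\blacktriangleright te+\{s(r)\otimes f_1e\}-\{f_1e\otimes s(r)\}-\{s\partial_1e\otimes s(r)\},$$ and $g_0=f_0+\partial_1's$, $g_1=f_1+s\partial_1+\partial_2't$, $g_2=f_2+t\partial_2$. A 2-fold homotopy $(f,s,t)\Rightarrow(f,s',t')$ is a quadratic $(f,s,t)$-2-derivation, that is, a linear map $q:R\to L'$ with $$q(rr')=f_0(r)\blacktriangleright q(r')+f_0(r')\blacktriangleright q(r)+s(r)\blacktriangleright' q(r')+s(r')\blacktriangleright' q(r)+q(r)q(r'),$$ such that $s'=s+\partial_2'q$ and $t'=t-q\partial_1$. **Operations.** Let $\mathcal A$ be free up to order one with chosen basis $B$ of $R$. Let $(R'\ltimes E')\ltimes(E'\ltimes L')$ be the semidirect product for the action $(r,e)\blacktriangleright_\bullet(e',l)=(ee'+r\blacktriangleright e',\ \partial_1'(e)\blacktriangleright l+r\blacktriangleright l-\{e'\otimes e\})$, where $E'\ltimes L'$ is formed with $\blacktriangleright'$. For homotopies $(f,s,t):f\to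 g$ and $(g,u,v):g\to h$, let $s\boxplus u$ be the unique $f_0$-derivation agreeing with $s+u$ on $B$; let $w^{(s,u)}:R\to L'$ be the last component of the unique algebra map $R\to(R'\ltimes E')\ltimes(E'\ltimes L')$ with $b\mapsto(f_0(b),s(b),u(b),0)$ for $b\in B$; and let $t\boxplus v=t+v+w^{(s,u)}\partial_1$. For $q:(f,s,t)\Rightarrow(f,s',t')$ and $q':(g,u,v)\Rightarrow(g,u',v')$, where $(f,s,t),(f,s',t'):f\to g$ and $(g,u,v),(g,u',v'):g\to h$, let $q\circledcirc u$ and $s\circledcirc q'$ be the unique quadratic $(f,s\boxplus u,t\boxplus v)$-2-derivations agreeing on $B$ with $q$ and with $q'$, respectively. Vertical composition is $q\star p=q+p$. **Theorem.** For all such $q,q'$, $$(q\circledcirc u)\star(s'\circledcirc q')=(s\circledcirc q')\star(q\circledcirc u'),$$ and both sides equal $q\otimes q':=q+q'+w^{(s,u)}-w^{(s',u')}$, which is a 2-fold homotopy $(f,s\boxplus u,t\boxplus v)\Rightarrow(f,s'\boxplus u',t'\boxplus v')$ between homotopies $f\to h$ (the horizontal composite). Consequently there is a 2-groupoid $\mathrm{HOM}(\mathcal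 A,\mathcal A')_2$ (a strict 2-category in which all 1-morphisms are strictly invertible and all 2-morphisms are invertible) whose objects are the 2-crossed module maps $\mathcal A\to\mathcal A'$, whose 1-morphisms are the homotopies, with composition $(s\boxplus u,t\boxplus v)$ and identities $(0,0)$, and whose 2-morphisms are the 2-fold homotopies, with vertical composition $\star$, identities $0$, whiskerings $\circledcirc$ and horizontal composition $\otimes$. -/

import Mathlib

open CategoryTheory

universe u v v' w

/-! ### Commutative algebras, actions and semidirect products

A commutative `κ`-algebra, not necessarily with identity, is a `NonUnitalCommRing S` with
`[Module κ S] [IsScalarTower κ S S] [SMulCommClass κ S S]`; algebra maps are `S →ₙₐ[κ] T`. -/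

/-- `x` is an identity element of the commutative algebra `S`. -/
def IsIdentity {S : Type*} [NonUnitalCommRing S] (x : S) : Prop := ∀ y : S, x * y = y

/-- An action (by multipliers) of the algebra `S` on the algebra `M`. -/
structure AlgAction (κ : Type*) [CommRing κ] (S M : Type*) [NonUnitalCommRing S] [Module κ S]
    [NonUnitalCommRing M] [Module κ M] where
  act : S →ₗ[κ] M →ₗ[κ] M
  act_mul : ∀ r m m', act r (m * m') = act r m * m'
  mul_act : ∀ r r' m, act (r * r') m = act r (act r' m)

theorem AlgAction.act_mul' {κ : Type*} [CommRing κ] {S M : Type*} [NonUnitalCommRing S]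
    [Module κ S] [NonUnitalCommRing M] [Module κ M] (α : AlgAction κ S M) (r : S) (m m' : M) :
    α.act r (m * m') = m * α.act r m' := by
  rw [mul_comm, α.act_mul, mul_comm]

theorem AlgAction.act_comm {κ : Type*} [CommRing κ] {S M : Type*} [NonUnitalCommRing S]
    [Module κ S] [NonUnitalCommRing M] [Module κ M] (α : AlgAction κ S M) (r r' : S) (m : M) :
    α.act r (α.act r' m) = α.act r' (α.act r m) := by
  rw [← α.mul_act, mul_comm, α.mul_act]

/-- The semidirect product `S ⋉ M`: pairs with
`(r, m) (r', m') = (r r', r ▸ m' + r' ▸ m + m m')`. -/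
@[ext] structure SemiProd {κ : Type*} [CommRing κ] {S M : Type*} [NonUnitalCommRing S]
    [Module κ S] [NonUnitalCommRing M] [Module κ M] (α : AlgAction κ S M) where
  fst : S
  snd : M

namespace SemiProd

section

variable {κ : Type*} [CommRing κ] {S M : Type*} [NonUnitalCommRing S] [Module κ S]
  [NonUnitalCommRing M] [Module κ M] {α : AlgAction κ S M}

/-- The underlying pair. -/
def toPair : SemiProd α ≃ S × M where
  toFun x := (x.1, x.2)
  invFun p := ⟨p.1, p.2⟩

instance : NonUnitalCommRing (SemiProd α) where
  __ := (toPair (α := α)).addCommGroup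
  mul x y := ⟨x.1 * y.1, α.act x.1 y.2 + α.act y.1 x.2 + x.2 * y.2⟩
  left_distrib x y z := by
    refine SemiProd.ext (mul_add x.1 y.1 z.1) ?_
    change α.act x.1 (y.2 + z.2) + α.act (y.1 + z.1) x.2 + x.2 * (y.2 + z.2) =
      (α.act x.1 y.2 + α.act y.1 x.2 + x.2 * y.2) + (α.act x.1 z.2 + α.act z.1 x.2 + x.2 * z.2)
    simp only [map_add, LinearMap.add_apply, mul_add]
    abel
  right_distrib x y z := by
    refine SemiProd.ext (add_mul x.1 y.1 z.1) ?_
    change α.act (x.1 + y.1) z.2 + α.act z.1 (x.2 + y.2) + (x.2 + y.2) * z.2 =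
      (α.act x.1 z.2 + α.act z.1 x.2 + x.2 * z.2) + (α.act y.1 z.2 + α.act z.1 y.2 + y.2 * z.2)
    simp only [map_add, LinearMap.add_apply, add_mul]
    abel
  zero_mul x := by
    refine SemiProd.ext (zero_mul x.1) ?_
    change α.act 0 x.2 + α.act x.1 0 + 0 * x.2 = 0
    simp
  mul_zero x := by
    refine SemiProd.ext (mul_zero x.1) ?_
    change α.act x.1 0 + α.act 0 x.2 + x.2 * 0 = 0
    simp
  mul_assoc x y z := by
    refine SemiProd.ext (mul_assoc x.1 y.1 z.1) ?_
    change α.act (x.1 * y.1) z.2 + α.act z.1 (α.act x.1 y.2 + α.act y.1 x.2 + x.2 * y.2) +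
        (α.act x.1 y.2 + α.act y.1 x.2 + x.2 * y.2) * z.2 =
      α.act x.1 (α.act y.1 z.2 + α.act z.1 y.2 + y.2 * z.2) + α.act (y.1 * z.1) x.2 +
        x.2 * (α.act y.1 z.2 + α.act z.1 y.2 + y.2 * z.2)
    simp only [map_add, add_mul, mul_add, α.mul_act, ← α.act_mul, ← α.act_mul', mul_assoc,
      α.act_comm z.1]
    abel
  mul_comm x y := by
    refine SemiProd.ext (mul_comm x.1 y.1) ?_
    change α.act x.1 y.2 + α.act y.1 x.2 + x.2 * y.2 =
      α.act y.1 x.2 + α.act x.1 y.2 + y.2 * x.2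
    rw [mul_comm x.2, add_comm (α.act x.1 y.2)]

instance : Module κ (SemiProd α) where
  smul k x := ⟨k • x.1, k • x.2⟩
  one_smul x := SemiProd.ext (one_smul κ x.1) (one_smul κ x.2)
  mul_smul k k' x := SemiProd.ext (mul_smul k k' x.1) (mul_smul k k' x.2)
  smul_zero k := SemiProd.ext (smul_zero k) (smul_zero k)
  smul_add k x y := SemiProd.ext (smul_add k x.1 y.1) (smul_add k x.2 y.2)
  add_smul k k' x := SemiProd.ext (add_smul k k' x.1) (add_smul k k' x.2)
  zero_smul x := SemiProd.ext (zero_smul κ x.1) (zero_smul κ x.2)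

@[simp] theorem add_fst (x y : SemiProd α) : (x + y).1 = x.1 + y.1 := rfl
@[simp] theorem add_snd (x y : SemiProd α) : (x + y).2 = x.2 + y.2 := rfl
@[simp] theorem zero_fst : (0 : SemiProd α).1 = 0 := rfl
@[simp] theorem zero_snd : (0 : SemiProd α).2 = 0 := rfl
@[simp] theorem smul_fst (k : κ) (x : SemiProd α) : (k • x).1 = k • x.1 := rfl
@[simp] theorem smul_snd (k : κ) (x : SemiProd α) : (k • x).2 = k • x.2 := rfl
@[simp] theorem mul_fst (x y : SemiProd α) : (x * y).1 = x.1 * y.1 := rfl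
@[simp] theorem mul_snd (x y : SemiProd α) :
    (x * y).2 = α.act x.1 y.2 + α.act y.1 x.2 + x.2 * y.2 := rfl

instance [IsScalarTower κ S S] [IsScalarTower κ M M] : IsScalarTower κ (SemiProd α) (SemiProd α) :=
  ⟨fun k x y => by
    refine SemiProd.ext ?_ ?_ <;> simp [smul_mul_assoc, smul_add]⟩

instance [SMulCommClass κ S S] [SMulCommClass κ M M] : SMulCommClass κ (SemiProd α) (SemiProd α) :=
  ⟨fun k x y => by
    refine SemiProd.ext ?_ ?_ <;> simp [mul_smul_comm, smul_add]⟩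

end

end SemiProd

/-! ### 2-crossed modules and their maps -/

/-- A 2-crossed module `L → E → R` of commutative `κ`-algebras.

The proposition `unital` records a convention for the base algebras `R`, the same for all
2-crossed modules considered. If it is false, nothing more is required. If it is true, `R` has an
identity, which acts identically on `E` and `L` (and maps of 2-crossed modules preserve it). -/
structure TwoCrossedModule (κ : Type u) [CommRing κ] (unital : Prop) where
  R : Type v
  E : Type v
  L : Type v
  [ringR : NonUnitalCommRing R]
  [modR : Module κ R]
  [towerR : IsScalarTower κ R R]
  [commR : SMulCommClass κ R R]
  [ringE : NonUnitalCommRing E]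
  [modE : Module κ E]
  [towerE : IsScalarTower κ E E]
  [commE : SMulCommClass κ E E]
  [ringL : NonUnitalCommRing L]
  [modL : Module κ L]
  [towerL : IsScalarTower κ L L]
  [commL : SMulCommClass κ L L]
  /-- the boundary maps -/
  d₁ : E →ₙₐ[κ] R
  d₂ : L →ₙₐ[κ] E
  /-- the actions of `R` on `E` and `L` -/
  actE : AlgAction κ R E
  actL : AlgAction κ R L
  /-- the Peiffer lifting `{e ⊗ e'}` -/
  lift : E →ₗ[κ] E →ₗ[κ] L
  d₁_d₂ : ∀ l, d₁ (d₂ l) = 0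
  d₁_act : ∀ r e, d₁ (actE.act r e) = r * d₁ e
  d₂_act : ∀ r l, d₂ (actL.act r l) = actE.act r (d₂ l)
  /-- the axioms of the Peiffer lifting -/
  d₂_lift : ∀ e e', d₂ (lift e e') = e * e' - actE.act (d₁ e') e
  lift_d₂_d₂ : ∀ l l', lift (d₂ l) (d₂ l') = l * l'
  lift_mul : ∀ e e' e'', lift e (e' * e'') = lift (e * e') e'' + actL.act (d₁ e'') (lift e e')
  /-- here `lift e (d₂ l)` is `e ▸' l`, see `TwoCrossedModule.actEL` -/
  lift_d₂ : ∀ l e, lift (d₂ l) e = lift e (d₂ l) - actL.act (d₁ e) l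
  act_lift_left : ∀ r e e', actL.act r (lift e e') = lift (actE.act r e) e'
  act_lift_right : ∀ r e e', actL.act r (lift e e') = lift e (actE.act r e')
  exists_identity : unital →
    ∃ x : R, IsIdentity x ∧ (∀ e, actE.act x e = e) ∧ ∀ l, actL.act x l = l

namespace TwoCrossedModule

attribute [instance] ringR modR towerR commR ringE modE towerE commE ringL modL towerL commL

section

variable {κ : Type u} [CommRing κ] {unital : Prop}

/-- The action `e ▸' l = {e ⊗ ∂₂ l}` of `E` on `L`. -/
def actEL (A : TwoCrossedModule.{u, v} κ unital) : AlgAction κ A.E A.L where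
  act := A.lift.compl₂ (A.d₂ : A.L →ₗ[κ] A.E)
  act_mul e l l' := by
    change A.lift e (A.d₂ (l * l')) = A.lift e (A.d₂ l) * l'
    rw [map_mul, A.lift_mul, A.d₁_d₂, map_zero, LinearMap.zero_apply, add_zero,
      ← A.lift_d₂_d₂, A.d₂_lift, A.d₁_d₂, map_zero, LinearMap.zero_apply, sub_zero]
  mul_act e e' l := by
    change A.lift (e * e') (A.d₂ l) = A.lift e (A.d₂ (A.lift e' (A.d₂ l)))
    rw [A.d₂_lift, A.d₁_d₂, map_zero, LinearMap.zero_apply, sub_zero, A.lift_mul, A.d₁_d₂,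
      map_zero, LinearMap.zero_apply, add_zero]

theorem actEL_apply (A : TwoCrossedModule.{u, v} κ unital) (e : A.E) (l : A.L) :
    A.actEL.act e l = A.lift e (A.d₂ l) := rfl

/-- The algebra of 1-simplices `A₁ = R ⋉ E`. -/
abbrev Simplex₁ (A : TwoCrossedModule.{u, v} κ unital) : Type v := SemiProd A.actE

/-- The action `(r, e) ▸• (e', l) = (e e' + r ▸ e', ∂₁ e ▸ l + r ▸ l - {e' ⊗ e})` of `R ⋉ E`
on `E ⋉ L`. -/
def actBullet (A : TwoCrossedModule.{u, v} κ unital) :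
    AlgAction κ A.Simplex₁ (SemiProd A.actEL) where
  act := LinearMap.mk₂ κ
    (fun x y => ⟨x.2 * y.1 + A.actE.act x.1 y.1,
      A.actL.act (A.d₁ x.2) y.2 + A.actL.act x.1 y.2 - A.lift y.1 x.2⟩)
    (fun x x' y => by
      refine SemiProd.ext ?_ ?_
      · simp [add_mul]; abel
      · simp; abel)
    (fun c x y => by
      refine SemiProd.ext ?_ ?_
      · simp [smul_mul_assoc]
      · simp [smul_sub])
    (fun x y y' => by
      refine SemiProd.ext ?_ ?_
      · simp [mul_add]; abel
      · simp; abel)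
    (fun c x y => by
      refine SemiProd.ext ?_ ?_
      · simp [mul_smul_comm]
      · simp [smul_sub])
  act_mul x y y' := by
    refine SemiProd.ext ?_ ?_
    · simp [add_mul, mul_assoc, A.actE.act_mul]
    · have h₁ : A.lift y'.1 (A.d₂ (A.lift y.1 x.2)) =
          A.lift (y.1 * y'.1) x.2 := by
        rw [A.d₂_lift, map_sub, mul_comm y.1 x.2, ← A.act_lift_right, mul_comm x.2 y.1,
          A.lift_mul, mul_comm y'.1 y.1, add_sub_cancel_right]
      have h₂ : A.lift y.1 x.2 * y'.2 =
          A.lift (x.2 * y.1) (A.d₂ y'.2) - A.actL.act (A.d₁ x.2) (A.lift y.1 (A.d₂ y'.2)) := by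
        rw [← A.lift_d₂_d₂, A.d₂_lift, map_sub, LinearMap.sub_apply, A.act_lift_left,
          mul_comm y.1 x.2]
      simp only [SemiProd.mul_snd, SemiProd.mul_fst, LinearMap.mk₂_apply, A.actEL_apply, map_add,
        map_sub, LinearMap.add_apply, A.actL.act_mul, add_mul, sub_mul, h₁, h₂,
        ← A.act_lift_left, A.act_lift_right, A.d₂_act]
      abel
  mul_act x x' y := by
    refine SemiProd.ext ?_ ?_
    · simp only [SemiProd.mul_snd, SemiProd.mul_fst, LinearMap.mk₂_apply, map_add, add_mul,
        mul_add, A.actE.mul_act, mul_assoc, ← A.actE.act_mul, ← A.actE.act_mul',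
        LinearMap.add_apply]
      abel
    · simp only [SemiProd.mul_snd, SemiProd.mul_fst, LinearMap.mk₂_apply, map_add, map_sub,
        LinearMap.add_apply, map_mul, A.actL.mul_act, A.d₁_act, ← A.act_lift_left,
        ← A.act_lift_right, mul_comm x.2 x'.2, A.lift_mul, mul_comm x'.2 y.1,
        A.actL.act_comm (A.d₁ x.2) x'.1, A.actL.act_comm (A.d₁ x'.2) (A.d₁ x.2)]
      abel

theorem actBullet_apply (A : TwoCrossedModule.{u, v} κ unital) (x : A.Simplex₁)
    (y : SemiProd A.actEL) : A.actBullet.act x y = ⟨x.2 * y.1 + A.actE.act x.1 y.1,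
      A.actL.act (A.d₁ x.2) y.2 + A.actL.act x.1 y.2 - A.lift y.1 x.2⟩ := rfl

/-- The algebra of 2-simplices `A₂ = (R ⋉ E) ⋉ (E ⋉ L)`. The element `((r, e), (e', l))` is the
triangle with first edge `(r, e)`, second edge `(r + ∂₁ e, e' + ∂₂ l)` and third edge
`(r, e + e')`. -/
abbrev Simplex₂ (A : TwoCrossedModule.{u, v} κ unital) : Type v := SemiProd A.actBullet

/-- The action `(r, e) ▹ l = r ▸ l + e ▸' l` of `R ⋉ E` on `L`. -/
def actTri (A : TwoCrossedModule.{u, v} κ unital) : AlgAction κ A.Simplex₁ A.L where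
  act := LinearMap.mk₂ κ (fun x l => A.actL.act x.1 l + A.actEL.act x.2 l)
    (fun x x' y => by simp; abel) (fun c x y => by simp)
    (fun x y y' => by simp; abel) (fun c x y => by simp)
  act_mul x y y' := by
    simp [A.actL.act_mul, A.actEL.act_mul, add_mul]
  mul_act x x' y := by
    simp only [SemiProd.mul_snd, SemiProd.mul_fst, LinearMap.mk₂_apply, map_add,
      LinearMap.add_apply, A.actL.mul_act, A.actEL.mul_act]
    simp only [A.actEL_apply, A.d₂_act, ← A.act_lift_left, ← A.act_lift_right]
    abel

theorem actTri_apply (A : TwoCrossedModule.{u, v} κ unital) (x : A.Simplex₁) (l : A.L) :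
    A.actTri.act x l = A.actL.act x.1 l + A.actEL.act x.2 l := rfl

/-- The semidirect product `Q = (R ⋉ E) ⋉ L`. -/
abbrev QAlg (A : TwoCrossedModule.{u, v} κ unital) : Type v := SemiProd A.actTri

theorem exists_isIdentity_simplex₁ (A : TwoCrossedModule.{u, v} κ unital) (h : unital) :
    ∃ x : A.Simplex₁, IsIdentity x := by
  obtain ⟨x, h₁, h₂, -⟩ := A.exists_identity h
  exact ⟨⟨x, 0⟩, fun y => SemiProd.ext (by simp [h₁ y.1]) (by simp [h₂])⟩

theorem exists_isIdentity_simplex₂ (A : TwoCrossedModule.{u, v} κ unital) (h : unital) :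
    ∃ x : A.Simplex₂, IsIdentity x := by
  obtain ⟨x, h₁, h₂, h₃⟩ := A.exists_identity h
  refine ⟨⟨⟨x, 0⟩, 0⟩, fun y => SemiProd.ext (SemiProd.ext ?_ ?_) (SemiProd.ext ?_ ?_)⟩ <;>
    simp [h₁ _, h₂, h₃, actBullet_apply]

theorem exists_isIdentity_qAlg (A : TwoCrossedModule.{u, v} κ unital) (h : unital) :
    ∃ x : A.QAlg, IsIdentity x := by
  obtain ⟨x, h₁, h₂, h₃⟩ := A.exists_identity h
  refine ⟨⟨⟨x, 0⟩, 0⟩, fun y => SemiProd.ext (SemiProd.ext ?_ ?_) ?_⟩ <;>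
    simp [h₁ _, h₂, h₃, actTri_apply]

/-- A chosen free basis `b : ι → R`, making `A` free up to order one. If `unital` holds, it
identifies `R` with the polynomial algebra `κ[ι]`; otherwise it identifies `R` with the free
not necessarily unital commutative algebra on `ι`, that is, with the polynomials in `κ[ι]` whose
constant term is zero. -/
structure FreeBasis (A : TwoCrossedModule.{u, v} κ unital) (ι : Type w) where
  b : ι → A.R
  free : ∃ φ : A.R →ₙₐ[κ] MvPolynomial ι κ, Function.Injective φ ∧
    (∀ p, p ∈ Set.range φ ↔ unital ∨ MvPolynomial.constantCoeff p = 0) ∧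
    ∀ i, φ (b i) = MvPolynomial.X i

namespace FreeBasis

/-- The universal property of the free algebra `R`. -/
theorem existsUnique_extend {A : TwoCrossedModule.{u, v} κ unital} {ι : Type w}
    (B : FreeBasis A ι) {S : Type v'} [NonUnitalCommRing S] [Module κ S] [IsScalarTower κ S S]
    [SMulCommClass κ S S] (hS : unital → ∃ x : S, IsIdentity x) (c : ι → S) :
    ∃! ψ : A.R →ₙₐ[κ] S, (∀ i, ψ (B.b i) = c i) ∧
      (unital → ∀ x, IsIdentity x → IsIdentity (ψ x)) := by
  classical
  obtain ⟨φ, hinj, hran, hX⟩ := B.free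
  obtain ⟨o, ho⟩ : ∃ o : S, unital → IsIdentity o := by
    by_cases h : unital
    · obtain ⟨x, hx⟩ := hS h
      exact ⟨x, fun _ => hx⟩
    · exact ⟨0, fun h' => absurd h' h⟩
  have hone : unital → ∀ x, IsIdentity x → φ x = 1 := by
    intro h x hx
    obtain ⟨y, hy⟩ := (hran 1).2 (Or.inl h)
    have := congrArg φ (hx y)
    rwa [map_mul, hy, mul_one] at this
  let G : MvPolynomial ι κ →ₐ[κ] Unitization κ S :=
    MvPolynomial.aeval (fun i => (Unitization.inr (c i) : Unitization κ S))
  have hG : ∀ p, (G p).fst = MvPolynomial.constantCoeff p := by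
    intro p
    induction p using MvPolynomial.induction_on with
    | C a => simp [G, Unitization.algebraMap_eq_inl]
    | add p q hp hq => simp [hp, hq]
    | mul_X p i hp => simp [G, Unitization.fst_mul]
  have hsmul : ∀ r (s : S), MvPolynomial.constantCoeff (φ r) • (o * s) =
      MvPolynomial.constantCoeff (φ r) • s := by
    intro r s
    rcases (hran (φ r)).1 ⟨r, rfl⟩ with h | h
    · rw [ho h s]
    · rw [h, zero_smul, zero_smul]
  let ψ : A.R →ₙₐ[κ] S :=
    { toFun := fun r => MvPolynomial.constantCoeff (φ r) • o + (G (φ r)).snd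
      map_smul' := by
        intro k r
        simp [smul_add, mul_smul]
      map_zero' := by simp
      map_add' := by
        intro r r'
        simp only [map_add, Unitization.snd_add, add_smul]
        abel
      map_mul' := by
        intro r r'
        have h₁ := hsmul r (G (φ r')).snd
        have h₂ := hsmul r' (G (φ r)).snd
        have h₃ := hsmul r o
        simp only [map_mul, Unitization.snd_mul, hG, mul_add, add_mul, smul_mul_assoc,
          mul_smul_comm, h₁, mul_comm (G (φ r)).snd o]
        rw [smul_add, h₃, h₂, mul_comm (MvPolynomial.constantCoeff (φ r)), mul_smul]
        abel }
  refine ⟨ψ, ⟨fun i => ?_, fun h x hx => ?_⟩, ?_⟩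
  · simp [ψ, hX, G]
  · have : ψ x = o := by simp [ψ, hone h x hx]
    rw [this]
    exact ho h
  · rintro χ ⟨hχ, hχ₁⟩
    have hψ : ∀ i, ψ (B.b i) = c i := fun i => by simp [ψ, hX, G]
    have hψ₁ : unital → ∀ x, IsIdentity x → ψ x = o := fun h x hx => by simp [ψ, hone h x hx]
    have key : ∀ p : MvPolynomial ι κ, ∃ r, φ r = p - MvPolynomial.C (MvPolynomial.constantCoeff p)
        ∧ χ r = ψ r := by
      intro p
      induction p using MvPolynomial.induction_on with
      | C a => exact ⟨0, by simp, by simp⟩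
      | add p q hp hq =>
        obtain ⟨r, hr, hr'⟩ := hp
        obtain ⟨t, ht, ht'⟩ := hq
        exact ⟨r + t, by rw [map_add, hr, ht]; simp; ring, by rw [map_add, map_add, hr', ht']⟩
      | mul_X p i hp =>
        obtain ⟨r, hr, hr'⟩ := hp
        refine ⟨r * B.b i + MvPolynomial.constantCoeff p • B.b i, ?_, ?_⟩
        · rw [map_add, map_mul, map_smul, hr, hX, MvPolynomial.smul_eq_C_mul]
          simp
          ring
        · rw [map_add, map_add, map_mul, map_mul, map_smul, map_smul, hr', hχ, hψ]
    refine NonUnitalAlgHom.ext fun r => ?_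
    obtain ⟨t, ht, ht'⟩ := key (φ r)
    rcases (hran (φ r)).1 ⟨r, rfl⟩ with h | h
    · obtain ⟨x, hx, -⟩ := A.exists_identity h
      have hr : r = t + MvPolynomial.constantCoeff (φ r) • x := by
        apply hinj
        rw [map_add, map_smul, ht, hone h x hx, MvPolynomial.smul_eq_C_mul]
        ring
      have hx' : χ x = ψ x := by
        rw [hψ₁ h x hx, ← hχ₁ h x hx o, mul_comm, ho h]
      rw [hr, map_add, map_add, map_smul, map_smul, ht', hx']
    · have hr : r = t := by
        apply hinj
        rw [ht, h, map_zero, sub_zero]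
      rw [hr, ht']

/-- The unique algebra map (preserving identities, if `unital` holds) extending a map given on
the basis. -/
noncomputable def extend {A : TwoCrossedModule.{u, v} κ unital} {ι : Type w}
    (B : FreeBasis A ι) {S : Type v'} [NonUnitalCommRing S] [Module κ S] [IsScalarTower κ S S]
    [SMulCommClass κ S S] (hS : unital → ∃ x : S, IsIdentity x) (c : ι → S) : A.R →ₙₐ[κ] S :=
  (B.existsUnique_extend hS c).choose

end FreeBasis

/-- Maps of 2-crossed modules. -/
structure Map (A : TwoCrossedModule.{u, v} κ unital) (A' : TwoCrossedModule.{u, v'} κ unital) where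
  f₀ : A.R →ₙₐ[κ] A'.R
  f₁ : A.E →ₙₐ[κ] A'.E
  f₂ : A.L →ₙₐ[κ] A'.L
  comm₁ : ∀ e, f₀ (A.d₁ e) = A'.d₁ (f₁ e)
  comm₂ : ∀ l, f₁ (A.d₂ l) = A'.d₂ (f₂ l)
  map_actE : ∀ r e, f₁ (A.actE.act r e) = A'.actE.act (f₀ r) (f₁ e)
  map_actL : ∀ r l, f₂ (A.actL.act r l) = A'.actL.act (f₀ r) (f₂ l)
  map_lift : ∀ e e', f₂ (A.lift e e') = A'.lift (f₁ e) (f₁ e')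
  map_identity : unital → ∀ x, IsIdentity x → IsIdentity (f₀ x)

end

section

variable {κ : Type u} [CommRing κ] {unital : Prop} {A : TwoCrossedModule.{u, v} κ unital}
  {A' : TwoCrossedModule.{u, v'} κ unital}

/-! ### Homotopies and 2-fold homotopies -/

/-- `s` is an `f₀`-derivation, that is, `r ↦ (f₀ r, s r)` is an algebra map `R → A'₁`. -/
structure IsDerivation (f : Map A A') (s : A.R →ₗ[κ] A'.E) : Prop where
  map_mul : ∀ r r', s (r * r') =
    A'.actE.act (f.f₀ r) (s r') + A'.actE.act (f.f₀ r') (s r) + s r * s r'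
  map_identity : unital → ∀ x, IsIdentity x → s x = 0

/-- `(s, t)` is a quadratic `f`-derivation. -/
structure IsQuadraticDerivation (f : Map A A') (s : A.R →ₗ[κ] A'.E) (t : A.E →ₗ[κ] A'.L) :
    Prop where
  isDerivation : IsDerivation f s
  map_mul : ∀ e e', t (e * e') =
    A'.lift (s (A.d₁ e)) (f.f₁ e') + A'.lift (s (A.d₁ e')) (f.f₁ e)
      + A'.actEL.act (f.f₁ e) (t e') + A'.actEL.act (f.f₁ e') (t e)
      + A'.actEL.act (s (A.d₁ e)) (t e') + A'.actEL.act (s (A.d₁ e')) (t e) + t e * t e'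
  map_act : ∀ r e, t (A.actE.act r e) =
    A'.actL.act (f.f₀ r) (t e) + A'.actL.act (A'.d₁ (s r)) (t e) + A'.lift (s r) (f.f₁ e)
      - A'.lift (f.f₁ e) (s r) - A'.lift (s (A.d₁ e)) (s r)

/-- `(f, s, t)` connects `f` to `g`. -/
structure Connects (f : Map A A') (s : A.R →ₗ[κ] A'.E) (t : A.E →ₗ[κ] A'.L) (g : Map A A') :
    Prop where
  eq₀ : ∀ r, g.f₀ r = f.f₀ r + A'.d₁ (s r)
  eq₁ : ∀ e, g.f₁ e = f.f₁ e + s (A.d₁ e) + A'.d₂ (t e)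
  eq₂ : ∀ l, g.f₂ l = f.f₂ l + t (A.d₂ l)

/-- Homotopies `(f, s, t)` from `f` to `g`. -/
@[ext] structure Homotopy (f g : Map A A') where
  s : A.R →ₗ[κ] A'.E
  t : A.E →ₗ[κ] A'.L
  isQuadraticDerivation : IsQuadraticDerivation f s t
  connects : Connects f s t g

/-- `q` is a quadratic `(f, s, t)`-2-derivation. -/
structure IsQuadratic2Derivation {f g : Map A A'} (a : Homotopy f g) (q : A.R →ₗ[κ] A'.L) :
    Prop where
  map_mul : ∀ r r', q (r * r') =
    A'.actL.act (f.f₀ r) (q r') + A'.actL.act (f.f₀ r') (q r)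
      + A'.actEL.act (a.s r) (q r') + A'.actEL.act (a.s r') (q r) + q r * q r'
  map_identity : unital → ∀ x, IsIdentity x → q x = 0

/-- `q` is a 2-fold homotopy from `(f, s, t)` to `(f, s', t')`. -/
structure IsTwoHomotopy {f g : Map A A'} (a a' : Homotopy f g) (q : A.R →ₗ[κ] A'.L) : Prop where
  isQuadratic2Derivation : IsQuadratic2Derivation a q
  s_eq : ∀ r, a'.s r = a.s r + A'.d₂ (q r)
  t_eq : ∀ e, a'.t e = a.t e - q (A.d₁ e)

/-- 2-fold homotopies from `(f, s, t)` to `(f, s', t')`. -/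
@[ext] structure TwoHomotopy {f g : Map A A'} (a a' : Homotopy f g) where
  q : A.R →ₗ[κ] A'.L
  isTwoHomotopy : IsTwoHomotopy a a' q

/-! ### The operations that depend on the chosen basis -/

variable {ι : Type w} (B : FreeBasis A ι)

namespace FreeBasis

/-- `s ⊞ s'`: the unique `f₀`-derivation that agrees with `s + s'` on the basis, as the last
component of the algebra map `(f₀, s ⊞ s') : R → A'₁`. -/
noncomputable def boxplus (f : Map A A') (s s' : A.R →ₗ[κ] A'.E) : A.R →ₗ[κ] A'.E where
  toFun r := (B.extend A'.exists_isIdentity_simplex₁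
    (fun i => ⟨f.f₀ (B.b i), s (B.b i) + s' (B.b i)⟩) r).snd
  map_add' := by simp
  map_smul' := by simp

/-- `w^{(s,s')}`: the last component of the unique algebra map `X^{(s,s')} : R → A'₂` that
sends a basis element `b` to the triangle `(f₀ b, s b, s' b, 0)`. -/
noncomputable def wMap (f : Map A A') (s s' : A.R →ₗ[κ] A'.E) : A.R →ₗ[κ] A'.L where
  toFun r := (B.extend A'.exists_isIdentity_simplex₂
    (fun i => ⟨⟨f.f₀ (B.b i), s (B.b i)⟩, ⟨s' (B.b i), 0⟩⟩) r).snd.snd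
  map_add' := by simp
  map_smul' := by simp

/-- The unique quadratic 2-derivation over `(f, s ⊞ u)` that agrees with `q` on the basis, as the
last component of the algebra map `R → Q'` that sends a basis element `b` to
`(f₀ b, s b + u b, q b)`. -/
noncomputable def whisker (f : Map A A') (s u : A.R →ₗ[κ] A'.E) (q : A.R →ₗ[κ] A'.L) :
    A.R →ₗ[κ] A'.L where
  toFun r := (B.extend A'.exists_isIdentity_qAlg
    (fun i => ⟨⟨f.f₀ (B.b i), s (B.b i) + u (B.b i)⟩, q (B.b i)⟩) r).snd
  map_add' := by simp
  map_smul' := by simp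

/-- Right whiskering `q ⊚ u` of `q : (f, s, t) ⇒ (f, s', t')` by `(g, u, v) : g → h`. -/
noncomputable def whiskerR {f g h : Map A A'} {a a' : Homotopy f g} (q : TwoHomotopy a a')
    (c : Homotopy g h) : A.R →ₗ[κ] A'.L :=
  B.whisker f a.s c.s q.q

/-- Left whiskering `s ⊚ q'` of `q' : (g, u, v) ⇒ (g, u', v')` by `(f, s, t) : f → g`. -/
noncomputable def whiskerL {f g h : Map A A'} (a : Homotopy f g) {c c' : Homotopy g h}
    (q' : TwoHomotopy c c') : A.R →ₗ[κ] A'.L :=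
  B.whisker f a.s c.s q'.q

/-- The horizontal composite `q ⊗ q' = q + q' + w^{(s,u)} - w^{(s',u')}` of
`q : (f, s, t) ⇒ (f, s', t')` and `q' : (g, u, v) ⇒ (g, u', v')`. -/
noncomputable def horiz {f g h : Map A A'} {a a' : Homotopy f g} {c c' : Homotopy g h}
    (q : TwoHomotopy a a') (q' : TwoHomotopy c c') : A.R →ₗ[κ] A'.L :=
  q.q + q'.q + B.wMap f a.s c.s - B.wMap f a'.s c'.s

/-- The homotopy `k` is the concatenation `(f, s ⊞ u, t ⊞ v)` of `(f, s, t) : f → g` and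
`(g, u, v) : g → h`, where `t ⊞ v = t + v + w^{(s,u)} ∘ ∂₁`. -/
structure IsConcatenation {f g h : Map A A'} (a : Homotopy f g) (c : Homotopy g h)
    (k : Homotopy f h) : Prop where
  s_eq : k.s = B.boxplus f a.s c.s
  t_eq : ∀ e, k.t e = a.t e + c.t e + B.wMap f a.s c.s (A.d₁ e)

end FreeBasis

end

end TwoCrossedModule

/-- A 2-groupoid: a strict 2-category in which every 1-morphism has a strict inverse and every
2-morphism is invertible. -/
structure IsTwoGroupoid (C : Type*) [Bicategory C] : Prop where
  strict : Bicategory.Strict C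
  inv₁ : ∀ {x y : C} (a : x ⟶ y), ∃ b : y ⟶ x, a ≫ b = 𝟙 x ∧ b ≫ a = 𝟙 y
  inv₂ : ∀ {x y : C} {a b : x ⟶ y} (α : a ⟶ b), IsIso α

/-!
Everything rests on one map: `w = w^{(s,u)}`, the last component of the algebra map
`X : R → A'₂` that sends a basis element `b` to the triangle `(f₀ b, s b, u b, 0)`. The three edges
of a triangle are algebra maps `A'₂ → A'₁`, so the edges of `X` are determined on the basis: they
are `(f₀, s)`, `(g₀, u)` and `(f₀, s ⊞ u)`. Hence `∂₂ w = s + u - s ⊞ u`, and the product of `A'₂`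
gives, with `p = s ⊞ u`,
`w (r r') = f₀ r ▸ w r' + f₀ r' ▸ w r + {p r ⊗ ∂₂ w r'} + {p r' ⊗ ∂₂ w r} + {∂₂ w r ⊗ ∂₂ w r'}`
`- {u r ⊗ s r'} - {u r' ⊗ s r}` (`FreeBasis.wMap_spec`).

Two general facts turn all identities into linear algebra. A linear map on `R` is determined by its
values on the basis (and on the identity, in the unital case) and a rule for its values at
products (`FreeBasis.linearMap_ext`). And once
`∂₁ e ▸ l = {e ⊗ ∂₂ l} - {∂₂ l ⊗ e}` and `l l' = {∂₂ l ⊗ ∂₂ l'}` are used, and the boundaries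
`∂₂ w`, `∂₂ q` are replaced by their values in `E'`, each rule for products is a sum of terms
`f₀ r ▸ l` and of liftings of values of derivations. The two sides of each identity below then
differ by a sum of terms `{∂₂ l ⊗ ∂₂ l'} - {∂₂ l' ⊗ ∂₂ l}`, which vanish because `L'` is
commutative. In this way one obtains
* the cocycle identity `w^{(s,u)} + w^{(s ⊞ u,z)} = w^{(u,z)} + w^{(s,u ⊞ z)}`
  (`FreeBasis.wMap_cocycle`), which is the associativity of concatenation;
* the equivalence of the rules for `v` and for `t ⊞ v`, given those for `t`
  (`FreeBasis.concat_map_mul_iff`, `FreeBasis.concat_map_act_iff`): in one direction this is the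
  existence of concatenations, in the other that of inverses, since `0 = t ⊞ t̄` obeys the rules;
* that `q ⊗ q' = q + q' + w^{(s,u)} - w^{(s',u')}` is a 2-fold homotopy between the concatenations
  (`FreeBasis.isTwoHomotopy_horiz`).

The whiskerings are the cases `q' = 0` and `q = 0` of the last point, by uniqueness, so
`q ⊚ u = q + w^{(s,u)} - w^{(s',u)}` and `s ⊚ q' = q' + w^{(s,u)} - w^{(s,u')}`. The interchange law
and the axioms of a bicategory become identities in the group of linear maps `R → L'`, where for
the compatibility of whiskering with concatenation the cocycle identity is used once more.
-/

/-! ### Identity elements and linear projections -/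

theorem IsIdentity.eq {S : Type*} [NonUnitalCommRing S] {x y : S} (hx : IsIdentity x)
    (hy : IsIdentity y) : x = y := by
  rw [← hy x, mul_comm, hx]

namespace SemiProd

variable {κ : Type*} [CommRing κ] {S M : Type*} [NonUnitalCommRing S] [Module κ S]
  [NonUnitalCommRing M] [Module κ M]

/-- The projection `S ⋉ M → S` as a linear map. -/
def fstₗ (α : AlgAction κ S M) : SemiProd α →ₗ[κ] S where
  toFun := fst
  map_add' _ _ := rfl
  map_smul' _ _ := rfl

/-- The projection `S ⋉ M → M` as a linear map. -/
def sndₗ (α : AlgAction κ S M) : SemiProd α →ₗ[κ] M where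
  toFun := snd
  map_add' _ _ := rfl
  map_smul' _ _ := rfl

@[simp] theorem fstₗ_apply {α : AlgAction κ S M} (x : SemiProd α) : fstₗ α x = x.fst := rfl
@[simp] theorem sndₗ_apply {α : AlgAction κ S M} (x : SemiProd α) : sndₗ α x = x.snd := rfl

end SemiProd

namespace TwoCrossedModule

variable {κ : Type u} [CommRing κ] {unital : Prop} {A : TwoCrossedModule.{u, v} κ unital}
  {A' : TwoCrossedModule.{u, v'} κ unital}

theorem Simplex₁.isIdentity_fst {x : A.Simplex₁} (h : unital) (hx : IsIdentity x) :
    IsIdentity x.1 ∧ x.2 = 0 := by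
  obtain ⟨y, h₁, h₂, -⟩ := A.exists_identity h
  have hy : IsIdentity (⟨y, 0⟩ : A.Simplex₁) :=
    fun z => SemiProd.ext (by simp [h₁ z.1]) (by simp [h₂])
  rw [hx.eq hy]
  exact ⟨h₁, rfl⟩

theorem Simplex₂.isIdentity_fst {x : A.Simplex₂} (h : unital) (hx : IsIdentity x) :
    IsIdentity x.1 ∧ x.2 = 0 := by
  obtain ⟨y, h₁, h₂, h₃⟩ := A.exists_identity h
  have hy₁ : IsIdentity (⟨y, 0⟩ : A.Simplex₁) :=
    fun z => SemiProd.ext (by simp [h₁ z.1]) (by simp [h₂])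
  have hy : IsIdentity (⟨⟨y, 0⟩, 0⟩ : A.Simplex₂) := by
    refine fun z => SemiProd.ext (SemiProd.ext ?_ ?_) (SemiProd.ext ?_ ?_) <;>
      simp [h₁ _, h₂, h₃, actBullet_apply]
  rw [hx.eq hy]
  exact ⟨hy₁, rfl⟩

theorem QAlg.isIdentity_fst {x : A.QAlg} (h : unital) (hx : IsIdentity x) :
    IsIdentity x.1 ∧ x.2 = 0 := by
  obtain ⟨y, h₁, h₂, h₃⟩ := A.exists_identity h
  have hy₁ : IsIdentity (⟨y, 0⟩ : A.Simplex₁) :=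
    fun z => SemiProd.ext (by simp [h₁ z.1]) (by simp [h₂])
  have hy : IsIdentity (⟨⟨y, 0⟩, 0⟩ : A.QAlg) := by
    refine fun z => SemiProd.ext (SemiProd.ext ?_ ?_) ?_ <;>
      simp [h₁ _, h₂, h₃, actTri_apply]
  rw [hx.eq hy]
  exact ⟨hy₁, rfl⟩

/-! ### Actions and products in `L` in terms of the Peiffer lifting -/

/-- Solving the last Peiffer axiom for the action of `∂₁ e`: restricted along `∂₁`, the action
of `R` on `L` is expressed by liftings alone. -/
theorem actL_d₁ (A : TwoCrossedModule.{u, v} κ unital) (e : A.E) (l : A.L) :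
    A.actL.act (A.d₁ e) l = A.lift e (A.d₂ l) - A.lift (A.d₂ l) e := by
  rw [A.lift_d₂, sub_sub_cancel]

/-- Commutativity of `L`, in terms of liftings. -/
theorem lift_d₂_comm (A : TwoCrossedModule.{u, v} κ unital) (l l' : A.L) :
    A.lift (A.d₂ l) (A.d₂ l') = A.lift (A.d₂ l') (A.d₂ l) := by
  rw [A.lift_d₂_d₂, A.lift_d₂_d₂, mul_comm]

/-! ### Uniqueness of maps determined by the basis -/

namespace FreeBasis

variable {ι : Type w} (B : FreeBasis A ι)

theorem extend_basis {S : Type*} [NonUnitalCommRing S] [Module κ S] [IsScalarTower κ S S]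
    [SMulCommClass κ S S] (hS : unital → ∃ x : S, IsIdentity x) (c : ι → S) (i : ι) :
    B.extend hS c (B.b i) = c i :=
  (B.existsUnique_extend hS c).choose_spec.1.1 i

theorem isIdentity_extend {S : Type*} [NonUnitalCommRing S] [Module κ S] [IsScalarTower κ S S]
    [SMulCommClass κ S S] (hS : unital → ∃ x : S, IsIdentity x) (c : ι → S) (h : unital)
    {x : A.R} (hx : IsIdentity x) : IsIdentity (B.extend hS c x) :=
  (B.existsUnique_extend hS c).choose_spec.1.2 h x hx

/-- The basis, together with the identity in the unital case, generates `R`: the universal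
property gives a retraction onto any subalgebra containing these elements. -/
theorem mem_of_basis_mem (S : NonUnitalSubalgebra κ A.R) (hb : ∀ i, B.b i ∈ S)
    (h₁ : unital → ∀ x, IsIdentity x → x ∈ S) (r : A.R) : r ∈ S := by
  have hS : unital → ∃ x : S, IsIdentity x := fun h => by
    obtain ⟨x, hx, -⟩ := A.exists_identity h
    exact ⟨⟨x, h₁ h x hx⟩, fun y => Subtype.ext (hx y)⟩
  have hR : unital → ∃ x : A.R, IsIdentity x := fun h => by
    obtain ⟨x, hx, -⟩ := A.exists_identity h
    exact ⟨x, hx⟩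
  let ψ : A.R →ₙₐ[κ] S := B.extend hS fun i => ⟨B.b i, hb i⟩
  have h : (NonUnitalSubalgebraClass.subtype S).comp ψ = NonUnitalAlgHom.id κ A.R := by
    refine (B.existsUnique_extend hR B.b).unique ⟨fun i => ?_, fun h x hx => ?_⟩
      ⟨fun i => rfl, fun _ x hx => hx⟩
    · exact congrArg Subtype.val (B.extend_basis hS _ i)
    · have hψ : ψ x = ⟨x, h₁ h x hx⟩ :=
        (B.isIdentity_extend hS _ h hx).eq fun y => Subtype.ext (hx y)
      change IsIdentity (ψ x : A.R)
      rwa [hψ]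
  have hr : (ψ r : A.R) = r := DFunLike.congr_fun h r
  rw [← hr]
  exact (ψ r).2

/-- Linear maps on `R` that agree on the basis, and whose values at a product are determined in
the same way by those at the factors, are equal. -/
theorem linearMap_ext {M : Type*} [AddCommGroup M] [Module κ M] {F G : A.R →ₗ[κ] M}
    (hb : ∀ i, F (B.b i) = G (B.b i)) (h₁ : unital → ∀ x, IsIdentity x → F x = G x)
    (hmul : ∀ r r', F r = G r → F r' = G r' → F (r * r') = G (r * r')) : F = G := by
  let S : NonUnitalSubalgebra κ A.R :=
    { carrier := {r | F r = G r}
      add_mem' := fun {r r'} (hr : F r = G r) (hr' : F r' = G r') => by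
        change F (r + r') = G (r + r')
        rw [map_add, map_add, hr, hr']
      zero_mem' := by simp
      mul_mem' := fun {r r'} hr hr' => hmul r r' hr hr'
      smul_mem' := fun k r (hr : F r = G r) => by
        change F (k • r) = G (k • r)
        rw [map_smul, map_smul, hr] }
  exact LinearMap.ext (B.mem_of_basis_mem S hb h₁)

theorem isDerivation_ext {f : Map A A'} {s s' : A.R →ₗ[κ] A'.E} (hs : IsDerivation f s)
    (hs' : IsDerivation f s') (hb : ∀ i, s (B.b i) = s' (B.b i)) : s = s' :=
  B.linearMap_ext hb (fun h x hx => by rw [hs.map_identity h x hx, hs'.map_identity h x hx])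
    fun r r' hr hr' => by rw [hs.map_mul, hs'.map_mul, hr, hr']

end FreeBasis

/-! ### The derivation `s ⊞ u` -/

namespace FreeBasis

variable {ι : Type w} (B : FreeBasis A ι)

section

variable (f : Map A A')

theorem extend_simplex₁_fst (c : ι → A'.E) (r : A.R) :
    (B.extend A'.exists_isIdentity_simplex₁ (fun i => ⟨f.f₀ (B.b i), c i⟩) r).1 = f.f₀ r := by
  refine LinearMap.congr_fun (B.linearMap_ext (F := SemiProd.fstₗ _ ∘ₗ
    (B.extend A'.exists_isIdentity_simplex₁ (fun i => ⟨f.f₀ (B.b i), c i⟩) :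
      A.R →ₗ[κ] A'.Simplex₁))
    (G := (f.f₀ : A.R →ₗ[κ] A'.R)) (fun i => ?_) (fun h x hx => ?_) fun r r' hr hr' => ?_) r
  · simp [extend_basis]
  · exact (Simplex₁.isIdentity_fst h (B.isIdentity_extend _ _ h hx)).1.eq (f.map_identity h x hx)
  · simp_all

theorem boxplus_basis (s u : A.R →ₗ[κ] A'.E) (i : ι) :
    B.boxplus f s u (B.b i) = s (B.b i) + u (B.b i) := by
  simp [boxplus, extend_basis]

theorem isDerivation_boxplus (s u : A.R →ₗ[κ] A'.E) : IsDerivation f (B.boxplus f s u) where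
  map_mul r r' := by
    change (B.extend A'.exists_isIdentity_simplex₁ _ (r * r')).2 = _
    rw [map_mul, SemiProd.mul_snd, extend_simplex₁_fst, extend_simplex₁_fst]
    rfl
  map_identity h _ hx := (Simplex₁.isIdentity_fst h (B.isIdentity_extend _ _ h hx)).2

end

/-- `∂₁ (s ⊞ u) = ∂₁ s + ∂₁ u`, since `f₀ + ∂₁ (s ⊞ u)` and `h₀` are algebra maps that agree on
the basis. -/
theorem d₁_boxplus {f g h : Map A A'} {s u : A.R →ₗ[κ] A'.E}
    (hg : ∀ r, g.f₀ r = f.f₀ r + A'.d₁ (s r)) (hh : ∀ r, h.f₀ r = g.f₀ r + A'.d₁ (u r)) (r : A.R) :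
    h.f₀ r = f.f₀ r + A'.d₁ (B.boxplus f s u r) := by
  refine LinearMap.congr_fun (B.linearMap_ext (F := (h.f₀ : A.R →ₗ[κ] A'.R))
    (G := (f.f₀ : A.R →ₗ[κ] A'.R) + (A'.d₁ : A'.E →ₗ[κ] A'.R) ∘ₗ B.boxplus f s u)
    (fun i => ?_) (fun hu x hx => ?_) fun r r' hr hr' => ?_) r
  · simp [boxplus_basis, hh, hg, add_assoc]
  · have := (B.isDerivation_boxplus f s u).map_identity hu x hx
    simpa [this] using (h.map_identity hu x hx).eq (f.map_identity hu x hx)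
  · change h.f₀ r = f.f₀ r + A'.d₁ (B.boxplus f s u r) at hr
    change h.f₀ r' = f.f₀ r' + A'.d₁ (B.boxplus f s u r') at hr'
    change h.f₀ (r * r') = f.f₀ (r * r') + A'.d₁ (B.boxplus f s u (r * r'))
    simp only [map_mul, hr, hr', (B.isDerivation_boxplus f s u).map_mul, map_add, A'.d₁_act,
      add_mul, mul_add, mul_comm (A'.d₁ _) (f.f₀ _)]
    abel

/-! ### The map `w^{(s,u)}` -/

theorem wMap_basis (f : Map A A') (s u : A.R →ₗ[κ] A'.E) (i : ι) : B.wMap f s u (B.b i) = 0 := by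
  simp [wMap, extend_basis]

theorem wMap_isIdentity (f : Map A A') (s u : A.R →ₗ[κ] A'.E) (h : unital) {x : A.R}
    (hx : IsIdentity x) : B.wMap f s u x = 0 :=
  congrArg SemiProd.snd (Simplex₂.isIdentity_fst h (B.isIdentity_extend _ _ h hx)).2

/-- The first edge of the triangle `X^{(s,u)}` is `(f₀, s)`. -/
theorem extend_simplex₂_fst {f : Map A A'} {s : A.R →ₗ[κ] A'.E} (hs : IsDerivation f s)
    (u : A.R →ₗ[κ] A'.E) (r : A.R) :
    (B.extend A'.exists_isIdentity_simplex₂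
      (fun i => ⟨⟨f.f₀ (B.b i), s (B.b i)⟩, ⟨u (B.b i), 0⟩⟩) r).1 = ⟨f.f₀ r, s r⟩ := by
  let F : A.R →ₗ[κ] A'.Simplex₁ :=
    { toFun := fun r => ⟨f.f₀ r, s r⟩
      map_add' := fun _ _ => SemiProd.ext (map_add _ _ _) (map_add _ _ _)
      map_smul' := fun _ _ => SemiProd.ext (map_smul _ _ _) (map_smul _ _ _) }
  let X : A.R →ₗ[κ] A'.Simplex₂ := B.extend A'.exists_isIdentity_simplex₂
    (fun i => ⟨⟨f.f₀ (B.b i), s (B.b i)⟩, ⟨u (B.b i), 0⟩⟩)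
  refine LinearMap.congr_fun (B.linearMap_ext (F := SemiProd.fstₗ _ ∘ₗ X) (G := F)
    (fun i => congrArg SemiProd.fst (B.extend_basis _ _ i)) (fun h x hx => ?_)
    fun r r' hr hr' => ?_) r
  · refine (Simplex₂.isIdentity_fst h (B.isIdentity_extend _ _ h hx)).1.eq fun y => ?_
    obtain ⟨z, h₁, h₂, -⟩ := A'.exists_identity h
    have hz : f.f₀ x = z := (f.map_identity h x hx).eq h₁
    refine SemiProd.ext ?_ ?_ <;> simp [F, hz, h₁ _, h₂, hs.map_identity h x hx]
  · refine (congrArg SemiProd.fst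
      (map_mul (B.extend A'.exists_isIdentity_simplex₂ _) r r')).trans ?_
    refine (congrArg₂ (· * ·) hr hr').trans (SemiProd.ext ?_ ?_)
    · simp [F]
    · simp [F, hs.map_mul]

/-- The defining properties of `w = w^{(s,u)}`. The second edge of the triangle `X^{(s,u)}` is
`(g₀, u)` and its third edge is `(f₀, s ⊞ u)`, whence `∂₂ w = s + u - s ⊞ u`; the value of `w` at
a product is read off from the product of `A'₂`. -/
theorem wMap_spec {f g : Map A A'} {s u : A.R →ₗ[κ] A'.E} (hs : IsDerivation f s)
    (hg : ∀ r, g.f₀ r = f.f₀ r + A'.d₁ (s r)) (hu : IsDerivation g u) :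
    (∀ r, A'.d₂ (B.wMap f s u r) = s r + u r - B.boxplus f s u r) ∧
    ∀ r r', B.wMap f s u (r * r') =
      A'.actL.act (f.f₀ r) (B.wMap f s u r') + A'.actL.act (f.f₀ r') (B.wMap f s u r)
        + A'.lift (B.boxplus f s u r) (A'.d₂ (B.wMap f s u r'))
        + A'.lift (B.boxplus f s u r') (A'.d₂ (B.wMap f s u r))
        + A'.lift (A'.d₂ (B.wMap f s u r)) (A'.d₂ (B.wMap f s u r'))
        - A'.lift (u r) (s r') - A'.lift (u r') (s r) := by
  set w := B.wMap f s u with hw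
  let X : A.R →ₗ[κ] A'.Simplex₂ := B.extend A'.exists_isIdentity_simplex₂
    (fun i => ⟨⟨f.f₀ (B.b i), s (B.b i)⟩, ⟨u (B.b i), 0⟩⟩)
  let x : A.R →ₗ[κ] A'.E := SemiProd.fstₗ _ ∘ₗ SemiProd.sndₗ _ ∘ₗ X
  have hx : ∀ r, (X r).2.1 = x r := fun r => rfl
  have hwr : ∀ r, (X r).2.2 = w r := fun r => rfl
  have hX : ∀ r r', X (r * r') = X r * X r' := fun r r' =>
    map_mul (B.extend A'.exists_isIdentity_simplex₂ _) r r'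
  have hX₁ : ∀ r, (X r).1 = ⟨f.f₀ r, s r⟩ := B.extend_simplex₂_fst hs u
  have hx_b : ∀ i, x (B.b i) = u (B.b i) := fun i =>
    congrArg (fun z => z.2.1) (B.extend_basis A'.exists_isIdentity_simplex₂ _ i)
  have hx_id : unital → ∀ y, IsIdentity y → x y = 0 := fun h y hy =>
    congrArg SemiProd.fst (Simplex₂.isIdentity_fst h (B.isIdentity_extend _ _ h hy)).2
  have hx_mul : ∀ r r', x (r * r') = s r * x r' + A'.actE.act (f.f₀ r) (x r')
      + (s r' * x r + A'.actE.act (f.f₀ r') (x r)) + x r * x r' := fun r r' => by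
    rw [← hx, hX, SemiProd.mul_snd, hX₁, hX₁]
    rfl
  have hw_mul : ∀ r r', w (r * r') =
      A'.actL.act (A'.d₁ (s r)) (w r') + A'.actL.act (f.f₀ r) (w r') - A'.lift (x r') (s r)
      + (A'.actL.act (A'.d₁ (s r')) (w r) + A'.actL.act (f.f₀ r') (w r)
        - A'.lift (x r) (s r'))
      + (A'.lift (x r) (A'.d₂ (w r')) + A'.lift (x r') (A'.d₂ (w r)) + w r * w r') :=
    fun r r' => by
      rw [← hwr, hX, SemiProd.mul_snd, hX₁, hX₁]
      rfl
  have third : s + x = B.boxplus f s u := by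
    refine B.isDerivation_ext ⟨fun r r' => ?_, fun h y hy => ?_⟩ (B.isDerivation_boxplus f s u)
      fun i => ?_
    · simp only [LinearMap.add_apply, hx_mul, hs.map_mul, map_add, add_mul, mul_add,
        mul_comm (x r) (s r')]
      abel
    · rw [LinearMap.add_apply, hs.map_identity h y hy, hx_id h y hy, add_zero]
    · rw [LinearMap.add_apply, hx_b, boxplus_basis]
  have second : x + (A'.d₂ : A'.L →ₗ[κ] A'.E) ∘ₗ w = u := by
    refine B.isDerivation_ext (f := g) ⟨fun r r' => ?_, fun h y hy => ?_⟩ hu fun i => ?_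
    · change x (r * r') + A'.d₂ (w (r * r')) = A'.actE.act (g.f₀ r) (x r' + A'.d₂ (w r'))
        + A'.actE.act (g.f₀ r') (x r + A'.d₂ (w r)) + (x r + A'.d₂ (w r)) * (x r' + A'.d₂ (w r'))
      simp only [hx_mul, hw_mul, hg, map_add, map_sub, map_mul, LinearMap.add_apply,
        A'.d₂_act, A'.d₂_lift, A'.d₁_d₂, map_zero, LinearMap.zero_apply, add_mul, mul_add,
        mul_comm (s _) (x _), mul_comm (A'.d₂ (w r)) (x r')]
      abel
    · change x y + A'.d₂ (w y) = 0
      rw [hx_id h y hy, hw, B.wMap_isIdentity f s u h hy, map_zero, add_zero]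
    · change x (B.b i) + A'.d₂ (w (B.b i)) = _
      rw [hx_b, hw, wMap_basis, map_zero, add_zero]
  have hxr : ∀ r, B.boxplus f s u r = s r + x r := fun r => LinearMap.congr_fun third.symm r
  have hur : ∀ r, u r = x r + A'.d₂ (w r) := fun r => LinearMap.congr_fun second.symm r
  refine ⟨fun r => ?_, fun r r' => ?_⟩
  · rw [hxr, hur]
    abel
  · simp only [hw_mul, hxr, hur, A'.actL_d₁, ← A'.lift_d₂_d₂, map_add, LinearMap.add_apply]
    abel

/-! ### The cocycle identity -/

theorem boxplus_assoc (f g : Map A A') (s u z : A.R →ₗ[κ] A'.E) :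
    B.boxplus f (B.boxplus f s u) z = B.boxplus f s (B.boxplus g u z) :=
  B.isDerivation_ext (B.isDerivation_boxplus f _ _) (B.isDerivation_boxplus f _ _) fun i => by
    simp only [boxplus_basis, add_assoc]

/-- The cocycle identity for `w`, which makes the concatenation of homotopies associative. Both
sides vanish on the basis and have the same boundary; at products they differ only by commutators
in `L`. -/
theorem wMap_cocycle {f g h : Map A A'} {s u z : A.R →ₗ[κ] A'.E} (hs : IsDerivation f s)
    (hg : ∀ r, g.f₀ r = f.f₀ r + A'.d₁ (s r)) (hu : IsDerivation g u)
    (hh : ∀ r, h.f₀ r = g.f₀ r + A'.d₁ (u r)) (hz : IsDerivation h z) :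
    B.wMap f s u + B.wMap f (B.boxplus f s u) z =
      B.wMap g u z + B.wMap f s (B.boxplus g u z) := by
  obtain ⟨d₁, m₁⟩ := B.wMap_spec hs hg hu
  obtain ⟨d₂, m₂⟩ := B.wMap_spec (B.isDerivation_boxplus f s u) (B.d₁_boxplus hg hh) hz
  obtain ⟨d₃, m₃⟩ := B.wMap_spec hu hh hz
  obtain ⟨d₄, m₄⟩ := B.wMap_spec hs hg (B.isDerivation_boxplus g u z)
  refine B.linearMap_ext (fun i => ?_) (fun h y hy => ?_) fun r r' hr hr' => ?_
  · simp only [LinearMap.add_apply, wMap_basis]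
  · simp only [LinearMap.add_apply, B.wMap_isIdentity _ _ _ h hy]
  · have c₁ := A'.lift_d₂_comm (B.wMap f s u r) (B.wMap f (B.boxplus f s u) z r')
    have c₂ := A'.lift_d₂_comm (B.wMap g u z r) (B.wMap f s (B.boxplus g u z) r')
    have k := congrArg (A'.actL.act (f.f₀ r)) hr'
    have k' := congrArg (A'.actL.act (f.f₀ r')) hr
    simp only [LinearMap.add_apply, m₁, m₂, m₃, m₄, hg, A'.actL_d₁, map_add, map_sub,
      LinearMap.sub_apply, d₁, d₂, d₃, d₄, B.boxplus_assoc f g] at c₁ c₂ k k' ⊢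
    linear_combination (norm := abel) k + k' - c₁ + c₂

/-! ### Concatenation of homotopies -/

/-- If `t` satisfies the rule for products, then `v` does if and only if `t ⊞ v` does. -/
theorem concat_map_mul_iff {f g : Map A A'} {s u : A.R →ₗ[κ] A'.E} {t v : A.E →ₗ[κ] A'.L}
    (hs : IsDerivation f s) (hg : Connects f s t g) (hu : IsDerivation g u) {e e' : A.E}
    (ht : t (e * e') = A'.lift (s (A.d₁ e)) (f.f₁ e') + A'.lift (s (A.d₁ e')) (f.f₁ e)
      + A'.actEL.act (f.f₁ e) (t e') + A'.actEL.act (f.f₁ e') (t e)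
      + A'.actEL.act (s (A.d₁ e)) (t e') + A'.actEL.act (s (A.d₁ e')) (t e) + t e * t e')
    {p : A.R →ₗ[κ] A'.E} (hp : B.boxplus f s u = p)
    {τ : A.E →ₗ[κ] A'.L} (hτ : ∀ e, τ e = t e + v e + B.wMap f s u (A.d₁ e)) :
    (v (e * e') = A'.lift (u (A.d₁ e)) (g.f₁ e') + A'.lift (u (A.d₁ e')) (g.f₁ e)
      + A'.actEL.act (g.f₁ e) (v e') + A'.actEL.act (g.f₁ e') (v e)
      + A'.actEL.act (u (A.d₁ e)) (v e') + A'.actEL.act (u (A.d₁ e')) (v e) + v e * v e') ↔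
    τ (e * e') = A'.lift (p (A.d₁ e)) (f.f₁ e') + A'.lift (p (A.d₁ e')) (f.f₁ e)
      + A'.actEL.act (f.f₁ e) (τ e') + A'.actEL.act (f.f₁ e') (τ e)
      + A'.actEL.act (p (A.d₁ e)) (τ e') + A'.actEL.act (p (A.d₁ e')) (τ e) + τ e * τ e' := by
  obtain ⟨d, m⟩ := B.wMap_spec hs hg.eq₀ hu
  rw [hp] at d m
  have c₁ := A'.lift_d₂_comm (t e + v e) (B.wMap f s u (A.d₁ e'))
  have c₂ := A'.lift_d₂_comm (v e) (t e')
  rw [← sub_eq_zero, ← sub_eq_zero (a := τ _)]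
  refine Eq.congr_left ?_
  simp only [hτ, ht, map_mul, m, f.comm₁, hg.eq₁, A'.actL_d₁, A'.actEL_apply, ← A'.lift_d₂_d₂,
    map_add, map_sub, LinearMap.add_apply, LinearMap.sub_apply, d] at c₁ c₂ ⊢
  linear_combination (norm := abel) c₁ + c₂

/-- If `t` satisfies the rule for the action, then `v` does if and only if `t ⊞ v` does. -/
theorem concat_map_act_iff {f g : Map A A'} {s u : A.R →ₗ[κ] A'.E} {t v : A.E →ₗ[κ] A'.L}
    (hs : IsDerivation f s) (hg : Connects f s t g) (hu : IsDerivation g u) {r : A.R} {e : A.E}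
    (ht : t (A.actE.act r e) =
      A'.actL.act (f.f₀ r) (t e) + A'.actL.act (A'.d₁ (s r)) (t e) + A'.lift (s r) (f.f₁ e)
      - A'.lift (f.f₁ e) (s r) - A'.lift (s (A.d₁ e)) (s r))
    {p : A.R →ₗ[κ] A'.E} (hp : B.boxplus f s u = p)
    {τ : A.E →ₗ[κ] A'.L} (hτ : ∀ e, τ e = t e + v e + B.wMap f s u (A.d₁ e)) :
    (v (A.actE.act r e) =
      A'.actL.act (g.f₀ r) (v e) + A'.actL.act (A'.d₁ (u r)) (v e) + A'.lift (u r) (g.f₁ e)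
      - A'.lift (g.f₁ e) (u r) - A'.lift (u (A.d₁ e)) (u r)) ↔
    τ (A.actE.act r e) =
      A'.actL.act (f.f₀ r) (τ e) + A'.actL.act (A'.d₁ (p r)) (τ e) + A'.lift (p r) (f.f₁ e)
      - A'.lift (f.f₁ e) (p r) - A'.lift (p (A.d₁ e)) (p r) := by
  obtain ⟨d, m⟩ := B.wMap_spec hs hg.eq₀ hu
  rw [hp] at d m
  have c₁ := A'.lift_d₂_comm (B.wMap f s u r) (t e + v e + B.wMap f s u (A.d₁ e))
  rw [← sub_eq_zero, ← sub_eq_zero (a := τ _)]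
  refine Eq.congr_left ?_
  simp only [hτ, ht, A.d₁_act, m, f.comm₁, hg.eq₀, hg.eq₁, A'.actL_d₁, map_add, map_sub,
    LinearMap.add_apply, LinearMap.sub_apply, d] at c₁ ⊢
  linear_combination (norm := abel) -c₁

end FreeBasis

theorem Homotopy.isDerivation {f g : Map A A'} (a : Homotopy f g) : IsDerivation f a.s :=
  a.isQuadraticDerivation.isDerivation

theorem isDerivation_zero (f : Map A A') : IsDerivation f (0 : A.R →ₗ[κ] A'.E) where
  map_mul _ _ := by simp
  map_identity _ _ _ := rfl

theorem isQuadraticDerivation_zero (f : Map A A') :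
    IsQuadraticDerivation f (0 : A.R →ₗ[κ] A'.E) (0 : A.E →ₗ[κ] A'.L) where
  isDerivation := isDerivation_zero f
  map_mul _ _ := by simp
  map_act _ _ := by simp

/-- The identity homotopy `(f, 0, 0)`. -/
def Homotopy.refl (f : Map A A') : Homotopy f f where
  s := 0
  t := 0
  isQuadraticDerivation := isQuadraticDerivation_zero f
  connects := ⟨by simp, by simp, by simp⟩

namespace FreeBasis

variable {ι : Type w} (B : FreeBasis A ι)

/-- The concatenation `(f, s ⊞ u, t ⊞ v)` of `(f, s, t) : f → g` and `(g, u, v) : g → h`. -/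
noncomputable def concat {f g h : Map A A'} (a : Homotopy f g) (c : Homotopy g h) :
    Homotopy f h where
  s := B.boxplus f a.s c.s
  t := a.t + c.t + B.wMap f a.s c.s ∘ₗ (A.d₁ : A.E →ₗ[κ] A.R)
  isQuadraticDerivation :=
    { isDerivation := B.isDerivation_boxplus f _ _
      map_mul := fun e e' => (B.concat_map_mul_iff a.isDerivation a.connects c.isDerivation
        (a.isQuadraticDerivation.map_mul e e') rfl fun _ => rfl).1
          (c.isQuadraticDerivation.map_mul e e')
      map_act := fun r e => (B.concat_map_act_iff a.isDerivation a.connects c.isDerivation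
        (a.isQuadraticDerivation.map_act r e) rfl fun _ => rfl).1
          (c.isQuadraticDerivation.map_act r e) }
  connects :=
    { eq₀ := B.d₁_boxplus a.connects.eq₀ c.connects.eq₀
      eq₁ := fun e => by
        change _ = _ + A'.d₂ (a.t e + c.t e + B.wMap f a.s c.s (A.d₁ e))
        rw [c.connects.eq₁, a.connects.eq₁, map_add, map_add,
          (B.wMap_spec a.isDerivation a.connects.eq₀ c.isDerivation).1]
        abel
      eq₂ := fun l => by
        change _ = _ + (a.t (A.d₂ l) + c.t (A.d₂ l) + B.wMap f a.s c.s (A.d₁ (A.d₂ l)))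
        rw [c.connects.eq₂, a.connects.eq₂, A.d₁_d₂, map_zero]
        abel }

theorem concat_t_apply {f g h : Map A A'} (a : Homotopy f g) (c : Homotopy g h) (e : A.E) :
    (B.concat a c).t e = a.t e + c.t e + B.wMap f a.s c.s (A.d₁ e) := rfl

theorem isConcatenation_concat {f g h : Map A A'} (a : Homotopy f g) (c : Homotopy g h) :
    B.IsConcatenation a c (B.concat a c) :=
  ⟨rfl, fun _ => rfl⟩

theorem concat_assoc {f g h k : Map A A'} (a : Homotopy f g) (c : Homotopy g h)
    (d : Homotopy h k) : B.concat (B.concat a c) d = B.concat a (B.concat c d) := by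
  refine Homotopy.ext (B.boxplus_assoc f g _ _ _) (LinearMap.ext fun e => ?_)
  have := LinearMap.congr_fun (B.wMap_cocycle a.isDerivation a.connects.eq₀ c.isDerivation
    c.connects.eq₀ d.isDerivation) (A.d₁ e)
  simp only [LinearMap.add_apply] at this
  simp only [concat_t_apply]
  change _ + B.wMap f (B.boxplus f a.s c.s) d.s (A.d₁ e) =
    _ + B.wMap f a.s (B.boxplus g c.s d.s) (A.d₁ e)
  linear_combination (norm := abel) this

theorem boxplus_zero {f : Map A A'} {s : A.R →ₗ[κ] A'.E} (hs : IsDerivation f s) :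
    B.boxplus f s 0 = s :=
  B.isDerivation_ext (B.isDerivation_boxplus f _ _) hs fun i => by simp [boxplus_basis]

theorem zero_boxplus {f : Map A A'} {s : A.R →ₗ[κ] A'.E} (hs : IsDerivation f s) :
    B.boxplus f 0 s = s :=
  B.isDerivation_ext (B.isDerivation_boxplus f _ _) hs fun i => by simp [boxplus_basis]

theorem wMap_refl {f g : Map A A'} (a : Homotopy f g) :
    B.wMap f a.s (Homotopy.refl g).s = 0 := by
  obtain ⟨-, m⟩ := B.wMap_spec a.isDerivation a.connects.eq₀ (isDerivation_zero g)
  refine B.linearMap_ext (fun i => B.wMap_basis f a.s 0 i)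
    (fun h x hx => B.wMap_isIdentity f a.s 0 h hx) fun r r' hr hr' => ?_
  change B.wMap f a.s 0 (r * r') = 0
  rw [m, show B.wMap f a.s 0 r = 0 from hr, show B.wMap f a.s 0 r' = 0 from hr']
  simp

theorem refl_wMap {f g : Map A A'} (a : Homotopy f g) :
    B.wMap f (Homotopy.refl f).s a.s = 0 := by
  obtain ⟨-, m⟩ := B.wMap_spec (isDerivation_zero f) (Homotopy.refl f).connects.eq₀ a.isDerivation
  refine B.linearMap_ext (fun i => B.wMap_basis f 0 a.s i)
    (fun h x hx => B.wMap_isIdentity f 0 a.s h hx) fun r r' hr hr' => ?_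
  change B.wMap f 0 a.s (r * r') = 0
  rw [m, show B.wMap f 0 a.s r = 0 from hr, show B.wMap f 0 a.s r' = 0 from hr']
  simp

theorem concat_refl {f g : Map A A'} (a : Homotopy f g) : B.concat a (Homotopy.refl g) = a := by
  refine Homotopy.ext (B.boxplus_zero a.isDerivation) (LinearMap.ext fun e => ?_)
  rw [concat_t_apply, wMap_refl]
  simp [Homotopy.refl]

theorem refl_concat {f g : Map A A'} (a : Homotopy f g) : B.concat (Homotopy.refl f) a = a := by
  refine Homotopy.ext (B.zero_boxplus a.isDerivation) (LinearMap.ext fun e => ?_)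
  rw [concat_t_apply, refl_wMap]
  simp [Homotopy.refl]

/-- Every homotopy has a right inverse `(g, s̄, t̄)`, where `s̄` is the `g₀`-derivation equal to
`-s` on the basis and `t̄ = -t - w^{(s,s̄)} ∂₁`. The rules for `t̄` hold since `s ⊞ s̄ = 0` and
`t ⊞ t̄ = 0` satisfy them. -/
theorem exists_concat_eq_refl {f g : Map A A'} (a : Homotopy f g) :
    ∃ c : Homotopy g f, B.concat a c = Homotopy.refl f := by
  let u : A.R →ₗ[κ] A'.E := B.boxplus g 0 (-a.s)
  have hu : IsDerivation g u := B.isDerivation_boxplus g _ _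
  have hp : B.boxplus f a.s u = 0 :=
    B.isDerivation_ext (B.isDerivation_boxplus f _ _) (isDerivation_zero f) fun i => by
      simp [u, boxplus_basis]
  let v : A.E →ₗ[κ] A'.L := -a.t - B.wMap f a.s u ∘ₗ (A.d₁ : A.E →ₗ[κ] A.R)
  have hv : ∀ e, v e = -a.t e - B.wMap f a.s u (A.d₁ e) := fun _ => rfl
  have hτ : ∀ e, (0 : A.E →ₗ[κ] A'.L) e = a.t e + v e + B.wMap f a.s u (A.d₁ e) := fun e => by
    rw [hv, LinearMap.zero_apply]
    abel
  have h₀ := isQuadraticDerivation_zero (A' := A') f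
  have eq₀ : ∀ r, f.f₀ r = g.f₀ r + A'.d₁ (u r) := fun r => by
    have hw := congrArg A'.d₁ ((B.wMap_spec a.isDerivation a.connects.eq₀ hu).1 r)
    rw [A'.d₁_d₂, hp, LinearMap.zero_apply, sub_zero, map_add] at hw
    rw [a.connects.eq₀, add_assoc, ← hw, add_zero]
  refine ⟨⟨u, v, ⟨hu, fun e e' => ?_, fun r e => ?_⟩, ⟨eq₀, fun e => ?_, fun l => ?_⟩⟩, ?_⟩
  · exact (B.concat_map_mul_iff a.isDerivation a.connects hu
      (a.isQuadraticDerivation.map_mul e e') hp hτ).2 (h₀.map_mul e e')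
  · exact (B.concat_map_act_iff a.isDerivation a.connects hu
      (a.isQuadraticDerivation.map_act r e) hp hτ).2 (h₀.map_act r e)
  · rw [hv, a.connects.eq₁, map_sub, map_neg,
      (B.wMap_spec a.isDerivation a.connects.eq₀ hu).1, hp, LinearMap.zero_apply]
    abel
  · rw [hv, a.connects.eq₂, A.d₁_d₂, map_zero]
    abel
  · exact Homotopy.ext hp (LinearMap.ext fun e => (hτ e).symm)

end FreeBasis

/-! ### Vertical composition of 2-fold homotopies -/

section

variable {f g : Map A A'} {a a' a'' : Homotopy f g}

theorem IsTwoHomotopy.map_mul {q : A.R →ₗ[κ] A'.L} (hq : IsTwoHomotopy a a' q) (r r' : A.R) :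
    q (r * r') = A'.actL.act (f.f₀ r) (q r') + A'.actL.act (f.f₀ r') (q r)
      + A'.lift (a.s r) (a'.s r' - a.s r') + A'.lift (a.s r') (a'.s r - a.s r)
      + A'.lift (a'.s r - a.s r) (a'.s r' - a.s r') := by
  simp only [hq.isQuadratic2Derivation.map_mul, A'.actEL_apply, ← A'.lift_d₂_d₂, hq.s_eq,
    add_sub_cancel_left]

theorem IsTwoHomotopy.d₂_apply {q : A.R →ₗ[κ] A'.L} (hq : IsTwoHomotopy a a' q) (r : A.R) :
    A'.d₂ (q r) = a'.s r - a.s r := by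
  rw [hq.s_eq, add_sub_cancel_left]

/-- A linear map with the right boundary is a 2-fold homotopy once it satisfies the rule for
products, written with `∂₂ q = s' - s`. -/
theorem IsTwoHomotopy.of_map_mul {q : A.R →ₗ[κ] A'.L}
    (hs : ∀ r, A'.d₂ (q r) = a'.s r - a.s r) (ht : ∀ e, a'.t e = a.t e - q (A.d₁ e))
    (h₁ : unital → ∀ x, IsIdentity x → q x = 0)
    (hmul : ∀ r r', q (r * r') = A'.actL.act (f.f₀ r) (q r') + A'.actL.act (f.f₀ r') (q r)
      + A'.lift (a.s r) (a'.s r' - a.s r') + A'.lift (a.s r') (a'.s r - a.s r)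
      + A'.lift (a'.s r - a.s r) (a'.s r' - a.s r')) : IsTwoHomotopy a a' q where
  isQuadratic2Derivation :=
    { map_mul := fun r r' => by
        simp only [hmul, A'.actEL_apply, ← A'.lift_d₂_d₂, hs]
      map_identity := h₁ }
  s_eq r := by rw [hs, add_sub_cancel]
  t_eq := ht

theorem isTwoHomotopy_zero (a : Homotopy f g) : IsTwoHomotopy a a 0 where
  isQuadratic2Derivation := ⟨by simp, fun _ _ _ => rfl⟩
  s_eq := by simp
  t_eq := by simp

/-- The identity 2-fold homotopy. -/
def TwoHomotopy.refl (a : Homotopy f g) : TwoHomotopy a a :=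
  ⟨0, isTwoHomotopy_zero a⟩

theorem IsTwoHomotopy.add {q p : A.R →ₗ[κ] A'.L} (hq : IsTwoHomotopy a a' q)
    (hp : IsTwoHomotopy a' a'' p) : IsTwoHomotopy a a'' (q + p) := by
  refine .of_map_mul (fun r => ?_) (fun e => ?_) (fun h x hx => ?_) fun r r' => ?_
  · rw [LinearMap.add_apply, map_add, hq.d₂_apply, hp.d₂_apply]
    abel
  · rw [LinearMap.add_apply, hp.t_eq, hq.t_eq, sub_sub]
  · rw [LinearMap.add_apply, hq.isQuadratic2Derivation.map_identity h x hx,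
      hp.isQuadratic2Derivation.map_identity h x hx, add_zero]
  · have c := A'.lift_d₂_comm (p r) (q r')
    simp only [hq.d₂_apply, hp.d₂_apply] at c
    simp only [LinearMap.add_apply, hq.map_mul, hp.map_mul, map_add, map_sub,
      LinearMap.sub_apply] at c ⊢
    linear_combination (norm := abel) -c

theorem IsTwoHomotopy.neg {q : A.R →ₗ[κ] A'.L} (hq : IsTwoHomotopy a a' q) :
    IsTwoHomotopy a' a (-q) := by
  refine .of_map_mul (fun r => ?_) (fun e => ?_) (fun h x hx => ?_) fun r r' => ?_
  · rw [LinearMap.neg_apply, map_neg, hq.d₂_apply, neg_sub]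
  · rw [LinearMap.neg_apply, hq.t_eq, sub_neg_eq_add, sub_add_cancel]
  · rw [LinearMap.neg_apply, hq.isQuadratic2Derivation.map_identity h x hx, neg_zero]
  · have c := A'.lift_d₂_comm (q r) (q r')
    simp only [hq.d₂_apply] at c
    simp only [LinearMap.neg_apply, hq.map_mul, map_neg, map_sub, LinearMap.sub_apply] at c ⊢
    linear_combination (norm := abel) -c

end

/-! ### Horizontal composition and whiskering -/

namespace FreeBasis

variable {ι : Type w} (B : FreeBasis A ι) {f g h : Map A A'} {a a' : Homotopy f g}
  {c c' : Homotopy g h}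

theorem isTwoHomotopy_horiz (q : TwoHomotopy a a') (q' : TwoHomotopy c c') :
    IsTwoHomotopy (B.concat a c) (B.concat a' c') (B.horiz q q') := by
  obtain ⟨d, m⟩ := B.wMap_spec a.isDerivation a.connects.eq₀ c.isDerivation
  obtain ⟨d', m'⟩ := B.wMap_spec a'.isDerivation a'.connects.eq₀ c'.isDerivation
  have hq := q.isTwoHomotopy
  have hq' := q'.isTwoHomotopy
  have hr : ∀ r, B.horiz q q' r =
    q.q r + q'.q r + B.wMap f a.s c.s r - B.wMap f a'.s c'.s r := fun _ => rfl
  refine .of_map_mul (fun r => ?_) (fun e => ?_) (fun h x hx => ?_) fun r r' => ?_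
  · rw [hr, map_sub, map_add, map_add, hq.d₂_apply, hq'.d₂_apply, d, d']
    simp only [concat]
    abel
  · rw [hr, concat_t_apply, concat_t_apply, hq.t_eq, hq'.t_eq]
    abel
  · rw [hr, hq.isQuadratic2Derivation.map_identity h x hx,
      hq'.isQuadratic2Derivation.map_identity h x hx, B.wMap_isIdentity _ _ _ h hx,
      B.wMap_isIdentity _ _ _ h hx]
    simp
  · -- `f₀` acts through `g₀ = f₀ + ∂₁ s` in the rule for `q'`; what remains are commutators in `L`
    have c₁ := A'.lift_d₂_comm (B.wMap f a'.s c'.s r)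
      (q.q r' + q'.q r' + B.wMap f a.s c.s r' - B.wMap f a'.s c'.s r')
    have c₂ := A'.lift_d₂_comm (q.q r) (q'.q r' + B.wMap f a.s c.s r')
    have c₃ := A'.lift_d₂_comm (q'.q r) (B.wMap f a.s c.s r')
    simp only [map_add, map_sub, hq.d₂_apply, hq'.d₂_apply, d, d'] at c₁ c₂ c₃
    simp only [hr, hq.map_mul, hq'.map_mul, m, m', concat, a.connects.eq₀, A'.actL_d₁, map_add,
      map_sub, LinearMap.add_apply, LinearMap.sub_apply, hq'.d₂_apply, d, d'] at c₁ c₂ c₃ ⊢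
    linear_combination (norm := abel) c₁ - c₂ - c₃

/-- A quadratic 2-derivation over a concatenation that agrees with `q` on the basis is the
whiskering `B.whisker f s u q`. -/
theorem whisker_eq {k : Homotopy f h} (hk : k.s = B.boxplus f a.s c.s) {q p : A.R →ₗ[κ] A'.L}
    (hp : IsQuadratic2Derivation k p) (hb : ∀ i, p (B.b i) = q (B.b i)) :
    B.whisker f a.s c.s q = p := by
  let X : A.R →ₗ[κ] A'.QAlg := B.extend A'.exists_isIdentity_qAlg
    (fun i => ⟨⟨f.f₀ (B.b i), a.s (B.b i) + c.s (B.b i)⟩, q (B.b i)⟩)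
  let F : A.R →ₗ[κ] A'.QAlg :=
    { toFun := fun r => ⟨⟨f.f₀ r, k.s r⟩, p r⟩
      map_add' := fun _ _ =>
        SemiProd.ext (SemiProd.ext (map_add _ _ _) (map_add _ _ _)) (map_add _ _ _)
      map_smul' := fun _ _ =>
        SemiProd.ext (SemiProd.ext (map_smul _ _ _) (map_smul _ _ _)) (map_smul _ _ _) }
  have hXF : X = F := by
    refine B.linearMap_ext (fun i => ?_) (fun h x hx => ?_) fun r r' hr hr' => ?_
    · refine (B.extend_basis _ _ i).trans ?_
      change _ = (⟨⟨f.f₀ (B.b i), k.s (B.b i)⟩, p (B.b i)⟩ : A'.QAlg)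
      rw [hk, boxplus_basis, hb]
    · refine (B.isIdentity_extend _ _ h hx).eq fun y => ?_
      obtain ⟨z, h₁, h₂, h₃⟩ := A'.exists_identity h
      have hz : f.f₀ x = z := (f.map_identity h x hx).eq h₁
      refine SemiProd.ext (SemiProd.ext ?_ ?_) ?_ <;>
        simp [F, hz, h₁ _, h₂, h₃, k.isDerivation.map_identity h x hx, hp.map_identity h x hx,
          actTri_apply]
    · refine (map_mul (B.extend A'.exists_isIdentity_qAlg _) r r').trans ?_
      refine (congrArg₂ (· * ·) hr hr').trans (SemiProd.ext (SemiProd.ext ?_ ?_) ?_)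
      · simp [F]
      · simp [F, k.isDerivation.map_mul]
      · simp only [F, LinearMap.coe_mk, AddHom.coe_mk, SemiProd.mul_snd, actTri_apply,
          hp.map_mul]
        abel
  exact LinearMap.ext fun r => congrArg SemiProd.snd (LinearMap.congr_fun hXF r)

theorem whiskerR_eq_horiz (q : TwoHomotopy a a') (c : Homotopy g h) :
    B.whiskerR q c = B.horiz q (TwoHomotopy.refl c) :=
  B.whisker_eq rfl (B.isTwoHomotopy_horiz q (TwoHomotopy.refl c)).isQuadratic2Derivation
    fun i => by simp [horiz, TwoHomotopy.refl, wMap_basis]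

theorem whiskerL_eq_horiz (a : Homotopy f g) (q' : TwoHomotopy c c') :
    B.whiskerL a q' = B.horiz (TwoHomotopy.refl a) q' :=
  B.whisker_eq rfl (B.isTwoHomotopy_horiz (TwoHomotopy.refl a) q').isQuadratic2Derivation
    fun i => by simp [horiz, TwoHomotopy.refl, wMap_basis]

theorem whiskerR_eq (q : TwoHomotopy a a') (c : Homotopy g h) :
    B.whiskerR q c = q.q + B.wMap f a.s c.s - B.wMap f a'.s c.s := by
  simp [whiskerR_eq_horiz, horiz, TwoHomotopy.refl]

theorem whiskerL_eq (a : Homotopy f g) (q' : TwoHomotopy c c') :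
    B.whiskerL a q' = q'.q + B.wMap f a.s c.s - B.wMap f a.s c'.s := by
  simp [whiskerL_eq_horiz, horiz, TwoHomotopy.refl]

theorem whiskerR_add_whiskerL (q : TwoHomotopy a a') (q' : TwoHomotopy c c') :
    B.whiskerR q c + B.whiskerL a' q' = B.horiz q q' := by
  rw [whiskerR_eq, whiskerL_eq, horiz]
  abel

theorem whiskerL_add_whiskerR (q : TwoHomotopy a a') (q' : TwoHomotopy c c') :
    B.whiskerL a q' + B.whiskerR q c' = B.horiz q q' := by
  rw [whiskerR_eq, whiskerL_eq, horiz]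
  abel

end FreeBasis

/-! ### The 2-groupoid of maps -/

instance homotopyCategory (f g : Map A A') : Category (Homotopy f g) where
  Hom a a' := TwoHomotopy a a'
  id a := TwoHomotopy.refl a
  comp q p := ⟨q.q + p.q, q.isTwoHomotopy.add p.isTwoHomotopy⟩
  id_comp q := TwoHomotopy.ext (zero_add q.q)
  comp_id q := TwoHomotopy.ext (add_zero q.q)
  assoc q p o := TwoHomotopy.ext (add_assoc q.q p.q o.q)

section

variable {f g : Map A A'}

/-- The underlying linear map of a morphism of `homotopyCategory`. -/
def homQ {a a' : Homotopy f g} (q : a ⟶ a') : A.R →ₗ[κ] A'.L := TwoHomotopy.q q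

theorem homQ_ext {a a' : Homotopy f g} {q p : a ⟶ a'} (h : homQ q = homQ p) : q = p :=
  TwoHomotopy.ext h

theorem homQ_id (a : Homotopy f g) : homQ (𝟙 a) = 0 := rfl

theorem homQ_comp {a a' a'' : Homotopy f g} (q : a ⟶ a') (p : a' ⟶ a'') :
    homQ (q ≫ p) = homQ q + homQ p := rfl

theorem homQ_eqToHom {a a' : Homotopy f g} (h : a = a') : homQ (eqToHom h) = 0 := by
  subst h
  rfl

theorem isIso_twoHomotopy {a a' : Homotopy f g} (q : a ⟶ a') : IsIso q :=
  ⟨⟨⟨-TwoHomotopy.q q, (TwoHomotopy.isTwoHomotopy q).neg⟩,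
    TwoHomotopy.ext (add_neg_cancel _), TwoHomotopy.ext (neg_add_cancel _)⟩⟩

end

namespace FreeBasis

variable {ι : Type w} (B : FreeBasis A ι)

/-- Left whiskering as a morphism between concatenations. -/
noncomputable def homWhiskerL {f g h : Map A A'} (a : Homotopy f g) {c c' : Homotopy g h}
    (q : c ⟶ c') : B.concat a c ⟶ B.concat a c' :=
  TwoHomotopy.mk (B.whiskerL a q) (B.whiskerL_eq_horiz a q ▸ B.isTwoHomotopy_horiz _ q)

/-- Right whiskering as a morphism between concatenations. -/
noncomputable def homWhiskerR {f g h : Map A A'} {a a' : Homotopy f g} (q : a ⟶ a')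
    (c : Homotopy g h) : B.concat a c ⟶ B.concat a' c :=
  TwoHomotopy.mk (B.whiskerR q c) (B.whiskerR_eq_horiz q c ▸ B.isTwoHomotopy_horiz q _)

theorem homQ_homWhiskerL {f g h : Map A A'} (a : Homotopy f g) {c c' : Homotopy g h}
    (q : c ⟶ c') : homQ (B.homWhiskerL a q) = homQ q + B.wMap f a.s c.s - B.wMap f a.s c'.s :=
  B.whiskerL_eq a q

theorem homQ_homWhiskerR {f g h : Map A A'} {a a' : Homotopy f g} (q : a ⟶ a')
    (c : Homotopy g h) : homQ (B.homWhiskerR q c) =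
      homQ q + B.wMap f a.s c.s - B.wMap f a'.s c.s :=
  B.whiskerR_eq q c

theorem wMap_concat_cocycle {f g h k : Map A A'} (a : Homotopy f g) (c : Homotopy g h)
    (d : Homotopy h k) : B.wMap f (B.concat a c).s d.s =
      B.wMap g c.s d.s + B.wMap f a.s (B.concat c d).s - B.wMap f a.s c.s :=
  eq_sub_of_add_eq' (B.wMap_cocycle a.isDerivation a.connects.eq₀ c.isDerivation
    c.connects.eq₀ d.isDerivation)

/-- The 2-groupoid `HOM(A, A')₂` of maps, homotopies and 2-fold homotopies. All structural
2-morphisms come from equalities of 1-morphisms, and so have `q = 0`. -/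
@[reducible] noncomputable def mapBicategory : Bicategory.{max v v', max v v'} (Map A A') where
  Hom f g := Homotopy f g
  id f := Homotopy.refl f
  comp a c := B.concat a c
  homCategory f g := homotopyCategory f g
  whiskerLeft a _ _ q := B.homWhiskerL a q
  whiskerRight q c := B.homWhiskerR q c
  associator a c d := eqToIso (B.concat_assoc a c d)
  leftUnitor a := eqToIso (B.refl_concat a)
  rightUnitor a := eqToIso (B.concat_refl a)
  whiskerLeft_id a c := homQ_ext <| by
    rw [homQ_homWhiskerL, homQ_id, homQ_id]; abel
  whiskerLeft_comp a _ _ _ q p := homQ_ext <| by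
    simp only [homQ_homWhiskerL, homQ_comp]; abel
  id_whiskerLeft q := homQ_ext <| by
    simp only [homQ_homWhiskerL, homQ_comp, eqToIso.hom, eqToIso.inv, homQ_eqToHom,
      B.refl_wMap]
    abel
  comp_whiskerLeft a c _ _ q := homQ_ext <| by
    simp only [homQ_homWhiskerL, homQ_comp, eqToIso.hom, eqToIso.inv, homQ_eqToHom,
      B.wMap_concat_cocycle]
    abel
  id_whiskerRight a c := homQ_ext <| by
    rw [homQ_homWhiskerR, homQ_id, homQ_id]; abel
  comp_whiskerRight q p c := homQ_ext <| by
    simp only [homQ_homWhiskerR, homQ_comp]; abel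
  whiskerRight_id q := homQ_ext <| by
    simp only [homQ_homWhiskerR, homQ_comp, eqToIso.hom, eqToIso.inv, homQ_eqToHom,
      B.wMap_refl]
    abel
  whiskerRight_comp q c d := homQ_ext <| by
    simp only [homQ_homWhiskerR, homQ_comp, eqToIso.hom, eqToIso.inv, homQ_eqToHom,
      B.wMap_concat_cocycle]
    abel
  whisker_assoc a _ _ q d := homQ_ext <| by
    simp only [homQ_homWhiskerL, homQ_homWhiskerR, homQ_comp, eqToIso.hom, eqToIso.inv,
      homQ_eqToHom, B.wMap_concat_cocycle]
    abel
  whisker_exchange q p := homQ_ext <| by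
    simp only [homQ_homWhiskerL, homQ_homWhiskerR, homQ_comp]; abel
  -- whiskering by a homotopy changes a vanishing `q` by a difference of two equal maps `w`
  pentagon a c d e := homQ_ext <| by
    simp only [homQ_homWhiskerL, homQ_homWhiskerR, homQ_comp, eqToIso.hom, homQ_eqToHom,
      B.concat_assoc]
    abel
  triangle a c := homQ_ext <| by
    simp only [homQ_homWhiskerL, homQ_homWhiskerR, homQ_comp, eqToIso.hom, homQ_eqToHom,
      B.concat_refl, B.refl_concat]
    abel

theorem isTwoGroupoid_mapBicategory :
    @IsTwoGroupoid (Map A A') (B.mapBicategory (A' := A')) := by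
  let := B.mapBicategory (A' := A')
  refine ⟨⟨B.refl_concat, B.concat_refl, B.concat_assoc, fun _ => rfl, fun _ => rfl,
    fun _ _ _ => rfl⟩, fun {f g} a => ?_, isIso_twoHomotopy⟩
  obtain ⟨c, hc⟩ := B.exists_concat_eq_refl a
  obtain ⟨d, hd⟩ := B.exists_concat_eq_refl c
  -- a right inverse `d` of the right inverse `c` of `a` is `a` itself
  have had : a = d := by
    have := B.concat_assoc a c d
    rwa [hc, hd, B.refl_concat, B.concat_refl, eq_comm] at this
  exact ⟨c, hc, had ▸ hd⟩

end FreeBasis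

end TwoCrossedModule

open TwoCrossedModule Bicategory in
theorem mainTheorem1 {κ : Type u} [CommRing κ] {unital : Prop}
    (A : TwoCrossedModule.{u, v} κ unital) (A' : TwoCrossedModule.{u, v'} κ unital)
    {ι : Type w} (B : FreeBasis A ι) :
    -- the interchange law and the horizontal composition
    (∀ {f g h : Map A A'} {a a' : Homotopy f g} {c c' : Homotopy g h}
      (q : TwoHomotopy a a') (q' : TwoHomotopy c c'),
      B.whiskerR q c + B.whiskerL a' q' = B.whiskerL a q' + B.whiskerR q c' ∧
      B.whiskerR q c + B.whiskerL a' q' = B.horiz q q' ∧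
      ∃ k k' : Homotopy f h, B.IsConcatenation a c k ∧ B.IsConcatenation a' c' k' ∧
        IsTwoHomotopy k k' (B.horiz q q')) ∧
    -- the 2-groupoid of 2-crossed module maps, homotopies and 2-fold homotopies
    ∃ (_ : Bicategory.{max v v', max v v'} (Map A A'))
      (e₁ : ∀ {f g : Map A A'}, (f ⟶ g) ≃ Homotopy f g)
      (e₂ : ∀ {f g : Map A A'} {a b : f ⟶ g}, (a ⟶ b) ≃ TwoHomotopy (e₁ a) (e₁ b)),
      IsTwoGroupoid (Map A A') ∧
      (∀ f : Map A A', (e₁ (𝟙 f)).s = 0 ∧ (e₁ (𝟙 f)).t = 0) ∧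
      (∀ {f g h : Map A A'} (a : f ⟶ g) (c : g ⟶ h),
        B.IsConcatenation (e₁ a) (e₁ c) (e₁ (a ≫ c))) ∧
      (∀ {f g : Map A A'} (a : f ⟶ g), (e₂ (𝟙 a)).q = 0) ∧
      (∀ {f g : Map A A'} {a b c : f ⟶ g} (α : a ⟶ b) (β : b ⟶ c),
        (e₂ (α ≫ β)).q = (e₂ α).q + (e₂ β).q) ∧
      (∀ {f g h : Map A A'} {a a' : f ⟶ g} (α : a ⟶ a') (c : g ⟶ h),
        (e₂ (α ▷ c)).q = B.whiskerR (e₂ α) (e₁ c)) ∧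
      (∀ {f g h : Map A A'} (a : f ⟶ g) {c c' : g ⟶ h} (β : c ⟶ c'),
        (e₂ (a ◁ β)).q = B.whiskerL (e₁ a) (e₂ β)) ∧
      ∀ {f g h : Map A A'} {a a' : f ⟶ g} {c c' : g ⟶ h} (α : a ⟶ a') (β : c ⟶ c'),
        (α ▷ c) ≫ (a' ◁ β) = (a ◁ β) ≫ (α ▷ c') ∧
        (e₂ ((α ▷ c) ≫ (a' ◁ β))).q = B.horiz (e₂ α) (e₂ β) := by
  refine ⟨fun {f g h a a' c c'} q q' => ⟨?_, B.whiskerR_add_whiskerL q q', B.concat a c,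
    B.concat a' c', B.isConcatenation_concat a c, B.isConcatenation_concat a' c',
    B.isTwoHomotopy_horiz q q'⟩, ?_⟩
  · rw [B.whiskerR_add_whiskerL, B.whiskerL_add_whiskerR]
  · let := B.mapBicategory (A' := A')
    exact ⟨B.mapBicategory, Equiv.refl _, Equiv.refl _, B.isTwoGroupoid_mapBicategory,
      fun _ => ⟨rfl, rfl⟩, fun a c => B.isConcatenation_concat a c, fun _ => rfl, fun _ _ => rfl,
      fun _ _ => rfl, by intros; rfl, fun α β => ⟨(whisker_exchange α β).symm,
        B.whiskerR_add_whiskerL α β⟩⟩
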